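/- Let $T>0$ and fix $a\in(0,T)$. For complex-valued $p\in AC[0,T]$ (absolutely continuous) and $q\in L^1(0,T)$ consider the differential pencil $$y''(x)+\bigl[\lambda^2-2\lambda p(x)-q(x)\bigr]y(x)=0,\qquad x\in(0,T),\tag{1}$$ with spectral parameter $\lambda\in\mathbb C$ (solutions are understood with $y,y'\in AC[0,T]$ and (1) holding almost everywhere). For $(c,d)\in\{(0,a),(0,T),(a,T)\}$ let $L_{c,d}(p,q)$ be the boundary value problem for (1) with the conditions $y(c)=y(d)=0$. A number $\lambda$ is an eigenvalue of $L_{c,d}(p,q)$ if (1) has a nontrivial solution satisfying these conditions. Let $X_1(x,\lambda),X_2(x,\lambda)$ be the solutions of (1) with $X_1(0,\lambda)=X_2'(0,\lambda)=1$ and $X_1'(0,\lambda)=X_2(0,\lambda)=0$. The eigenvalues are exactly the zeros of the entire function $\Delta_{c,d}(\lambda)=X_1(c,\lambda)X_2(d,\lambda)-X_2(c,\lambda)X_1(d,\lambda)$; the spectrum $\Lambda_{c,d}(p,q)$ is the collection of these zeros counted with their multiplicities as zeros of $\Delta_{c,d}$. Let $(p,q)$ and $(\tilde p,\tilde q)$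 be two such pairs of coefficients with $\int_0^T p(x)\,dx=\int_0^T\tilde p(x)\,dx$, and assume that $L_{0,a}(p,q)$ and $L_{0,T}(p,q)$ have no common eigenvalue. If $$\Lambda_{0,a}(p,q)=\Lambda_{0,a}(\tilde p,\tilde q),\qquad \Lambda_{0,T}(p,q)=\Lambda_{0,T}(\tilde p,\tilde q),\qquad \Lambda_{a,T}(p,q)=\Lambda_{a,T}(\tilde p,\tilde q)$$ (counting multiplicities), then $p(x)=\tilde p(x)$ for all $x\in[0,T]$ and $q(x)=\tilde q(x)$ for almost every $x\in(0,T)$. -/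

import Mathlib

open MeasureTheory Set

noncomputable section

/-- `y`, with derivative `dy`, is a (Caratheodory) solution on `[0, T]` of the pencil equation
`y'' + (z ^ 2 - 2 z p(x) - q(x)) y = 0` with spectral parameter `z`: `y` is differentiable with
derivative `dy`, `dy` is absolutely continuous, and the equation holds almost everywhere. -/
structure IsPencilSolution (T : ℝ) (p q : ℝ → ℂ) (z : ℂ) (y dy : ℝ → ℂ) : Prop where
  hasDeriv : ∀ x ∈ Icc 0 T, HasDerivWithinAt y (dy x) (Icc 0 T) x
  absCont : AbsolutelyContinuousOnInterval dy 0 T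
  equation : ∀ᵐ x ∂(volume.restrict (Ioo 0 T)),
    ∃ ddy : ℂ, HasDerivAt dy ddy x ∧ ddy + (z ^ 2 - 2 * z * p x - q x) * y x = 0

/-- The solution with `y(0) = α`, `y'(0) = β`. Such a solution exists and is unique on `[0, T]`
when `p` is absolutely continuous and `q` is integrable; only its values there matter. -/
def pencilCauchy (T : ℝ) (p q : ℝ → ℂ) (α β : ℂ) (z : ℂ) : ℝ → ℂ :=
  Classical.epsilon fun y : ℝ → ℂ =>
    ∃ dy : ℝ → ℂ, IsPencilSolution T p q z y dy ∧ y 0 = α ∧ dy 0 = β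

/-- `X₁(x, z)`: the solution with `X₁(0) = 1`, `X₁'(0) = 0`. -/
def pencilX₁ (T : ℝ) (p q : ℝ → ℂ) (x : ℝ) (z : ℂ) : ℂ := pencilCauchy T p q 1 0 z x

/-- `X₂(x, z)`: the solution with `X₂(0) = 0`, `X₂'(0) = 1`. -/
def pencilX₂ (T : ℝ) (p q : ℝ → ℂ) (x : ℝ) (z : ℂ) : ℂ := pencilCauchy T p q 0 1 z x

/-- The characteristic function of the problem with conditions `y(c) = y(d) = 0`: the determinant
of the two boundary forms evaluated on the fundamental system `X₁, X₂`. -/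
def dirichletCharFun (T : ℝ) (p q : ℝ → ℂ) (c d : ℝ) (z : ℂ) : ℂ :=
  pencilX₁ T p q c z * pencilX₂ T p q d z - pencilX₂ T p q c z * pencilX₁ T p q d z

/-- The set of eigenvalues of the problem with conditions `y(c) = y(d) = 0`. -/
def dirichletEigenvalues (T : ℝ) (p q : ℝ → ℂ) (c d : ℝ) : Set ℂ :=
  {z | ∃ y dy : ℝ → ℂ, IsPencilSolution T p q z y dy ∧ (∃ x ∈ Icc 0 T, y x ≠ 0) ∧
    y c = 0 ∧ y d = 0}

/-- The spectrum, counted with multiplicity, of the problem with conditions `y(c) = y(d) = 0`,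
as the function that sends `z` to its multiplicity, that is, to its order as a zero of the
(entire) characteristic function; this is `0` when `z` is not an eigenvalue. -/
def dirichletSpectrum (T : ℝ) (p q : ℝ → ℂ) (c d : ℝ) (z : ℂ) : ℕ∞ :=
  analyticOrderAt (dirichletCharFun T p q c d) z

end

/-! Let `S_c(·, z)` be the solution vanishing at `c` with slope 1. Constancy of Wronskians gives
`Δ_{c,d}(z) = S_c(d, z)`. Factoring the equation to first order through `y' ∓ i(z - p)y` shows that
`z Δ_{c,d}(z)` equals `sin(z(d - c) - ∫_c^d p)` up to `O(exp(|Im z| |d - c|) / |z|)`. By Liouville,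
two such entire functions with the same length and the same zeros are proportional
(`IsSineType.exists_eq_const_mul`). Growth along both imaginary half-axes shows that the factor has
square 1 and ties it to the integrals of `p`. Equality of `∫_0^T p` makes the factor 1 for `(0,T)`,
hence the same sign `ε` for `(0,a)` and `(a,T)`.

The Wronskian of `S_0` and `S_T` at `a` reads `Δ_{0,T} = S_0(a) S_T'(a) + S_0'(a) Δ_{a,T}`. With
tildes for the second pencil, subtraction gives `Δ_{a,T} (ε S̃_0' - S_0')(a) = Δ_{0,a} (S_T' - ε
S̃_T')(a)`. Without common eigenvalues `Δ_{a,T}` does not vanish at the zeros of `Δ_{0,a}`, so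
`Δ_{0,a}` divides `(ε S̃_0' - S_0')(a)` with an entire quotient `F`. Thus the Weyl functions
`S_0'/S_0` at `a` of the two pencils differ by `F`, and so do the functions `S_T'/S_T`.

A Weyl function known modulo an entire function determines the pencil on its segment
(`coefficients_eq_of_weyl_eq`). No growth of `F` is needed: it enters only through combinations
whose product with `S(a)` is explicitly bounded. Applied on `[0,a]` and on `[a,T]`, this gives the
theorem. -/

/-! ### Complex-valued absolutely continuous functions. -/

/-- A differentiable function with continuous derivative on a compact interval is absolutely
continuous. -/
theorem absolutelyContinuousOnInterval_of_hasDerivWithinAt {F : Type*} [NormedAddCommGroup F]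
    [NormedSpace ℝ F] {a b : ℝ} {f f' : ℝ → F}
    (hf : ∀ x ∈ uIcc a b, HasDerivWithinAt f (f' x) (uIcc a b) x)
    (hf' : ContinuousOn f' (uIcc a b)) : AbsolutelyContinuousOnInterval f a b := by
  obtain ⟨C, hC⟩ := isCompact_uIcc.exists_bound_of_continuousOn hf'
  refine LipschitzOnWith.absolutelyContinuousOnInterval (K := C.toNNReal) ?_
  refine (convex_uIcc a b).lipschitzOnWith_of_nnnorm_hasDerivWithin_le hf fun x hx => ?_
  rw [← NNReal.coe_le_coe, coe_nnnorm]
  exact (hC x hx).trans (Real.le_coe_toNNReal C)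

theorem LipschitzWith.comp_absolutelyContinuousOnInterval {X Y : Type*} [PseudoMetricSpace X]
    [PseudoMetricSpace Y] {K : NNReal} {g : X → Y} (hg : LipschitzWith K g) {f : ℝ → X} {a b : ℝ}
    (hf : AbsolutelyContinuousOnInterval f a b) :
    AbsolutelyContinuousOnInterval (fun x => g (f x)) a b := by
  unfold AbsolutelyContinuousOnInterval at *
  refine squeeze_zero (fun t => Finset.sum_nonneg fun i _ => dist_nonneg) (fun t => ?_)
    (by simpa using hf.const_mul (K : ℝ))
  rw [Finset.mul_sum]
  exact Finset.sum_le_sum fun i _ => hg.dist_le_mul _ _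

theorem AbsolutelyContinuousOnInterval.complex_re {f : ℝ → ℂ} {a b : ℝ}
    (hf : AbsolutelyContinuousOnInterval f a b) :
    AbsolutelyContinuousOnInterval (fun x => (f x).re) a b :=
  Complex.reCLM.lipschitz.comp_absolutelyContinuousOnInterval hf

theorem AbsolutelyContinuousOnInterval.complex_im {f : ℝ → ℂ} {a b : ℝ}
    (hf : AbsolutelyContinuousOnInterval f a b) :
    AbsolutelyContinuousOnInterval (fun x => (f x).im) a b :=
  Complex.imCLM.lipschitz.comp_absolutelyContinuousOnInterval hf

theorem AbsolutelyContinuousOnInterval.complex_mul {f g : ℝ → ℂ} {a b : ℝ}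
    (hf : AbsolutelyContinuousOnInterval f a b) (hg : AbsolutelyContinuousOnInterval g a b) :
    AbsolutelyContinuousOnInterval (fun x => f x * g x) a b :=
  hf.fun_smul hg

theorem AbsolutelyContinuousOnInterval.ae_hasDerivAt_complex {f : ℝ → ℂ} {a b : ℝ}
    (hf : AbsolutelyContinuousOnInterval f a b) :
    ∀ᵐ x, x ∈ uIcc a b → HasDerivAt f (deriv f x) x := by
  filter_upwards [hf.complex_re.ae_differentiableAt, hf.complex_im.ae_differentiableAt]
    with x h1 h2 hx
  have h3 := (h1 hx).hasDerivAt.ofReal_comp.add ((h2 hx).hasDerivAt.ofReal_comp.mul_const Complex.I)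
  refine DifferentiableAt.hasDerivAt (HasDerivAt.differentiableAt (h3.congr_of_eventuallyEq ?_))
  exact Filter.Eventually.of_forall fun y => by simp [Complex.re_add_im]

theorem AbsolutelyContinuousOnInterval.intervalIntegrable_deriv_complex {f : ℝ → ℂ} {a b : ℝ}
    (hf : AbsolutelyContinuousOnInterval f a b) :
    IntervalIntegrable (deriv f) volume a b := by
  have h1 := hf.complex_re.intervalIntegrable_deriv
  have h2 := hf.complex_im.intervalIntegrable_deriv
  have h3 : IntervalIntegrable (fun x => ((deriv (fun x => (f x).re) x : ℝ) : ℂ)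
      + ((deriv (fun x => (f x).im) x : ℝ) : ℂ) * Complex.I) volume a b :=
    IntervalIntegrable.add ⟨h1.1.ofReal, h1.2.ofReal⟩
      (IntervalIntegrable.mul_const ⟨h2.1.ofReal, h2.2.ofReal⟩ _)
  refine h3.congr_ae ?_
  rw [Filter.EventuallyEq, ae_restrict_iff' measurableSet_uIoc]
  filter_upwards [hf.complex_re.ae_differentiableAt, hf.complex_im.ae_differentiableAt]
    with x h4 h5 hx
  have hx := uIoc_subset_uIcc hx
  have h6 := (h4 hx).hasDerivAt.ofReal_comp.add
    ((h5 hx).hasDerivAt.ofReal_comp.mul_const Complex.I)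
  rw [← h6.deriv]
  congr 1
  funext y
  simp [Complex.re_add_im]

theorem IntervalIntegrable.absolutelyContinuousOnInterval_complex {f : ℝ → ℂ} {a b c : ℝ}
    (h : IntervalIntegrable f volume a b) (hc : c ∈ uIcc a b) :
    AbsolutelyContinuousOnInterval (fun x => ∫ v in c..x, f v) a b := by
  have hr : IntervalIntegrable (fun x => (f x).re) volume a b := ⟨h.1.re, h.2.re⟩
  have hi : IntervalIntegrable (fun x => (f x).im) volume a b := ⟨h.1.im, h.2.im⟩
  have key : AbsolutelyContinuousOnInterval
      (fun x => ((∫ v in c..x, (f v).re : ℝ) : ℂ) + Complex.I • ((∫ v in c..x, (f v).im : ℝ) : ℂ))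
      a b :=
    (Complex.ofRealCLM.lipschitz.comp_absolutelyContinuousOnInterval
      (hr.absolutelyContinuousOnInterval_intervalIntegral hc)).fun_add
    ((Complex.ofRealCLM.lipschitz.comp_absolutelyContinuousOnInterval
      (hi.absolutelyContinuousOnInterval_intervalIntegral hc)).const_smul Complex.I)
  -- The splitting into real and imaginary parts is available only inside the interval, where `f` is
  -- integrable. The subintervals in the ε-δ form have their endpoints there.
  rw [absolutelyContinuousOnInterval_iff] at key ⊢
  intro ε hε
  obtain ⟨δ, hδ, H⟩ := key ε hε
  refine ⟨δ, hδ, fun E hE hs => ?_⟩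
  have aux : ∀ x ∈ uIcc a b, (∫ v in c..x, f v) = ((∫ v in c..x, (f v).re : ℝ) : ℂ)
      + Complex.I • ((∫ v in c..x, (f v).im : ℝ) : ℂ) := by
    intro x hx
    have hcx : IntervalIntegrable f volume c x := h.mono_set (uIcc_subset_uIcc hc hx)
    have h1 : (∫ v in c..x, (f v).re) = (∫ v in c..x, f v).re :=
      Complex.reCLM.intervalIntegral_comp_comm hcx
    have h2 : (∫ v in c..x, (f v).im) = (∫ v in c..x, f v).im :=
      Complex.imCLM.intervalIntegral_comp_comm hcx
    rw [h1, h2, smul_eq_mul, mul_comm, Complex.re_add_im]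
  refine lt_of_eq_of_lt (Finset.sum_congr rfl fun i hi => ?_) (H E hE hs)
  rw [aux _ (hE.1 i hi).1, aux _ (hE.1 i hi).2]

/-- Fundamental theorem of calculus for an absolutely continuous function. -/
theorem AbsolutelyContinuousOnInterval.integral_eq_sub_of_ae_hasDerivAt {f g : ℝ → ℂ} {a b : ℝ}
    (hf : AbsolutelyContinuousOnInterval f a b) (hg : IntervalIntegrable g volume a b)
    (hfg : ∀ᵐ x, x ∈ uIcc a b → HasDerivAt f (g x) x) {s x : ℝ} (hs : s ∈ uIcc a b)
    (hx : x ∈ uIcc a b) : ∫ t in s..x, g t = f x - f s := by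
  have h1 := hf.fun_sub (hg.absolutelyContinuousOnInterval_complex hs)
  obtain ⟨C, hC⟩ := h1.const_of_ae_hasDerivAt_zero (by
    filter_upwards [hfg, hg.ae_hasDerivAt_integral] with y h2 h3 hy
    simpa using! (h2 hy).sub (h3 hy s hs))
  have e1 := hC s hs
  have e2 := hC x hx
  simp only [intervalIntegral.integral_same, sub_zero] at e1
  rw [e1, ← e2]
  ring

theorem hasDerivWithinAt_integral_of_continuousOn {f : ℝ → ℂ} {T s x : ℝ}
    (hf : ContinuousOn f (Icc 0 T)) (hs : s ∈ Icc 0 T) (hx : x ∈ Icc 0 T) :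
    HasDerivWithinAt (fun u => ∫ t in s..u, f t) (f x) (Icc 0 T) x := by
  have hsub : uIcc s x ⊆ Icc 0 T := by
    have := uIcc_subset_uIcc (a₁ := s) (b₁ := x) (a₂ := 0) (b₂ := T)
    rw [uIcc_of_le (hs.1.trans hs.2)] at this
    exact this hs hx
  have : Fact (x ∈ Icc 0 T) := ⟨hx⟩
  exact intervalIntegral.integral_hasDerivWithinAt_right
    ((hf.mono hsub).intervalIntegrable)
    (hf.stronglyMeasurableAtFilter_nhdsWithin measurableSet_Icc x) (hf x hx)

/-- With `f` merely integrable the chain rule holds only almost everywhere, so absolute continuity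
of the powers must be established. The division by `n + 1` produces the factorials for the Volterra
iterates. -/
theorem integral_mul_primitive_pow {f : ℝ → ℝ} {T x : ℝ}
    (hf : IntervalIntegrable f volume 0 T) (hx : x ∈ Icc 0 T) (n : ℕ) :
    ∫ t in (0 : ℝ)..x, f t * (∫ s in (0 : ℝ)..t, f s) ^ n =
      (∫ s in (0 : ℝ)..x, f s) ^ (n + 1) / (n + 1) := by
  have hT : 0 ≤ T := hx.1.trans hx.2
  have hx' : uIcc 0 x ⊆ uIcc 0 T := by
    rw [uIcc_of_le hx.1, uIcc_of_le hT]; exact Icc_subset_Icc le_rfl hx.2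
  have h0 : IntervalIntegrable f volume 0 x := hf.mono_set hx'
  have hac : AbsolutelyContinuousOnInterval (fun t => ∫ s in (0 : ℝ)..t, f s) 0 x :=
    h0.absolutelyContinuousOnInterval_intervalIntegral left_mem_uIcc
  have hpow : ∀ k : ℕ, AbsolutelyContinuousOnInterval
      (fun t => (∫ s in (0 : ℝ)..t, f s) ^ (k + 1)) 0 x := by
    intro k
    induction k with
    | zero => simpa using hac
    | succ k ih => simpa only [pow_succ _ (k + 1)] using ih.fun_mul hac
  have key := (hpow n).integral_deriv_eq_sub
  have : ∫ t in (0 : ℝ)..x, deriv (fun t => (∫ s in (0 : ℝ)..t, f s) ^ (n + 1)) t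
      = ∫ t in (0 : ℝ)..x, (n + 1 : ℝ) * (f t * (∫ s in (0 : ℝ)..t, f s) ^ n) := by
    refine intervalIntegral.integral_congr_ae ?_
    filter_upwards [h0.ae_hasDerivAt_integral] with t ht hmem
    have := ((ht (uIoc_subset_uIcc hmem) 0 left_mem_uIcc).pow (n + 1)).deriv
    rw [show (fun t => (∫ s in (0 : ℝ)..t, f s) ^ (n + 1)) =
      (fun t => ∫ s in (0 : ℝ)..t, f s) ^ (n + 1) from rfl, this]
    push_cast
    ring_nf
  rw [this, intervalIntegral.integral_const_mul] at key
  simp only [intervalIntegral.integral_same, ne_eq, Nat.add_eq_zero_iff, one_ne_zero, and_false,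
    not_false_eq_true, zero_pow, sub_zero] at key
  rw [← key]
  field_simp

/-! ### Volterra operators on continuous functions. -/

theorem uIcc_subset_Icc_of_mem {T s x : ℝ} (hs : s ∈ Icc 0 T) (hx : x ∈ Icc 0 T) :
    uIcc s x ⊆ Icc 0 T :=
  (convex_Icc (0 : ℝ) T).ordConnected.uIcc_subset hs hx

theorem IntervalIntegrable.of_mem_Icc {F : Type*} [NormedAddCommGroup F] {f : ℝ → F} {T s x : ℝ}
    (hf : IntervalIntegrable f volume 0 T) (hs : s ∈ Icc 0 T) (hx : x ∈ Icc 0 T) :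
    IntervalIntegrable f volume s x :=
  hf.mono_set ((uIcc_subset_Icc_of_mem hs hx).trans (Icc_subset_uIcc))

theorem continuous_integral_mul_projIcc {T : ℝ} (hT : 0 ≤ T) {r : ℝ → ℂ}
    (hr : IntervalIntegrable r volume 0 T) (f : C(Icc (0 : ℝ) T, ℂ)) :
    Continuous fun x : Icc (0 : ℝ) T => ∫ t in (0 : ℝ)..x, r t * f (projIcc 0 T hT t) := by
  have h1 : IntervalIntegrable (fun t => r t * f (projIcc 0 T hT t)) volume 0 T :=
    hr.mul_continuousOn (f.continuous.comp continuous_projIcc).continuousOn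
  have h2 := (h1.absolutelyContinuousOnInterval_complex left_mem_uIcc).continuousOn
  rw [uIcc_of_le hT] at h2
  exact continuousOn_iff_continuous_domRestrict.mp h2

/-- The operator `f ↦ ∫₀ˣ r f` on `C([0, T], ℂ)`, as a linear map. -/
noncomputable def volterraLinear {T : ℝ} (hT : 0 ≤ T) (r : ℝ → ℂ)
    (hr : IntervalIntegrable r volume 0 T) :
    C(Icc (0 : ℝ) T, ℂ) →ₗ[ℂ] C(Icc (0 : ℝ) T, ℂ) where
  toFun f := ⟨fun x => ∫ t in (0 : ℝ)..x, r t * f (projIcc 0 T hT t),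
    continuous_integral_mul_projIcc hT hr f⟩
  map_add' f g := by
    ext x
    have h1 (f : C(Icc (0 : ℝ) T, ℂ)) :
        IntervalIntegrable (fun t => r t * f (projIcc 0 T hT t)) volume 0 x :=
      (hr.mul_continuousOn (f.continuous.comp continuous_projIcc).continuousOn).of_mem_Icc
        ⟨le_rfl, hT⟩ x.2
    simp only [ContinuousMap.coe_mk, ContinuousMap.add_apply, mul_add]
    exact intervalIntegral.integral_add (h1 f) (h1 g)
  map_smul' c f := by
    ext x
    refine Eq.trans ?_ (intervalIntegral.integral_const_mul c _)
    refine intervalIntegral.integral_congr fun t _ => ?_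
    simp only [ContinuousMap.smul_apply, smul_eq_mul]
    ring

theorem norm_volterraLinear_apply_le {T : ℝ} (hT : 0 ≤ T) {r : ℝ → ℂ}
    (hr : IntervalIntegrable r volume 0 T) (f : C(Icc (0 : ℝ) T, ℂ)) {b : ℝ → ℝ} (x : Icc (0 : ℝ) T)
    (hb : ∀ t : Icc (0 : ℝ) T, ‖f t‖ ≤ b t) (hbc : ContinuousOn b (Icc 0 T)) :
    ‖volterraLinear hT r hr f x‖ ≤ ∫ t in (0 : ℝ)..x, ‖r t‖ * b t := by
  refine intervalIntegral.norm_integral_le_of_norm_le x.2.1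
    (Filter.Eventually.of_forall fun t ht => ?_) ?_
  · have hmem : t ∈ Icc 0 T := ⟨ht.1.le, ht.2.trans x.2.2⟩
    rw [norm_mul, projIcc_of_mem hT hmem]
    exact mul_le_mul_of_nonneg_left (hb ⟨t, hmem⟩) (norm_nonneg _)
  · exact (hr.norm.of_mem_Icc ⟨le_rfl, hT⟩ x.2).mul_continuousOn
      (hbc.mono (uIcc_subset_Icc_of_mem ⟨le_rfl, hT⟩ x.2))

theorem integral_norm_mono {T : ℝ} {r : ℝ → ℂ} (hr : IntervalIntegrable r volume 0 T) {x : ℝ}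
    (hx : x ∈ Icc 0 T) : ∫ t in (0 : ℝ)..x, ‖r t‖ ≤ ∫ t in (0 : ℝ)..T, ‖r t‖ :=
  intervalIntegral.integral_mono_interval le_rfl hx.1 hx.2
    (Filter.Eventually.of_forall fun _ => norm_nonneg _) hr.norm

/-- The bounded operator `f ↦ ∫₀ˣ r f` on `C([0, T], ℂ)`. -/
noncomputable def volterra {T : ℝ} (hT : 0 ≤ T) (r : ℝ → ℂ)
    (hr : IntervalIntegrable r volume 0 T) :
    C(Icc (0 : ℝ) T, ℂ) →L[ℂ] C(Icc (0 : ℝ) T, ℂ) :=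
  (volterraLinear hT r hr).mkContinuous (∫ t in (0 : ℝ)..T, ‖r t‖) fun f => by
    have h0 : 0 ≤ ∫ t in (0 : ℝ)..T, ‖r t‖ :=
      intervalIntegral.integral_nonneg hT fun _ _ => norm_nonneg _
    rw [ContinuousMap.norm_le _ (mul_nonneg h0 (norm_nonneg _))]
    intro x
    refine (norm_volterraLinear_apply_le hT hr f (b := fun _ => ‖f‖) x
      (fun t => f.norm_coe_le_norm t) continuousOn_const).trans ?_
    rw [intervalIntegral.integral_mul_const]
    exact mul_le_mul_of_nonneg_right (integral_norm_mono hr x.2) (norm_nonneg _)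

theorem volterra_apply {T : ℝ} (hT : 0 ≤ T) {r : ℝ → ℂ} (hr : IntervalIntegrable r volume 0 T)
    (f : C(Icc (0 : ℝ) T, ℂ)) (x : Icc (0 : ℝ) T) :
    volterra hT r hr f x = ∫ t in (0 : ℝ)..x, r t * f (projIcc 0 T hT t) := rfl

theorem norm_volterra_apply_le {T : ℝ} (hT : 0 ≤ T) {r : ℝ → ℂ}
    (hr : IntervalIntegrable r volume 0 T) (f : C(Icc (0 : ℝ) T, ℂ)) {b : ℝ → ℝ} (x : Icc (0 : ℝ) T)
    (hb : ∀ t : Icc (0 : ℝ) T, ‖f t‖ ≤ b t) (hbc : ContinuousOn b (Icc 0 T)) :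
    ‖volterra hT r hr f x‖ ≤ ∫ t in (0 : ℝ)..x, ‖r t‖ * b t :=
  norm_volterraLinear_apply_le hT hr f x hb hbc

theorem continuousOn_integral_norm {T : ℝ} (hT : 0 ≤ T) {r : ℝ → ℂ}
    (hr : IntervalIntegrable r volume 0 T) :
    ContinuousOn (fun x => ∫ t in (0 : ℝ)..x, ‖r t‖) (Icc 0 T) := by
  have := (hr.norm.absolutelyContinuousOnInterval_intervalIntegral left_mem_uIcc).continuousOn
  rwa [uIcc_of_le hT] at this

theorem intervalIntegrable_one (T : ℝ) :
    IntervalIntegrable (fun _ : ℝ => (1 : ℂ)) volume 0 T := intervalIntegrable_const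

/-- The iterates of a second order Volterra operator. -/
theorem norm_volterra_pow_apply_le {T : ℝ} (hT : 0 ≤ T) {r : ℝ → ℂ}
    (hr : IntervalIntegrable r volume 0 T) (n : ℕ) (f : C(Icc (0 : ℝ) T, ℂ)) (x : Icc (0 : ℝ) T) :
    ‖((volterra hT _ (intervalIntegrable_one T) * volterra hT r hr) ^ n) f x‖ ≤
      ‖f‖ * T ^ n / n.factorial * (∫ t in (0 : ℝ)..x, ‖r t‖) ^ n := by
  induction n generalizing x with
  | zero => simpa using f.norm_coe_le_norm x
  | succ n ih =>
    rw [pow_succ']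
    set g := ((volterra hT _ (intervalIntegrable_one T) * volterra hT r hr) ^ n) f with hg
    have h1 : ∀ y : Icc (0 : ℝ) T, ‖volterra hT r hr g y‖ ≤
        ‖f‖ * T ^ n / n.factorial * ((∫ t in (0 : ℝ)..y, ‖r t‖) ^ (n + 1) / (n + 1)) := by
      intro y
      refine (norm_volterra_apply_le hT hr g (b := fun x =>
        ‖f‖ * T ^ n / n.factorial * (∫ t in (0 : ℝ)..x, ‖r t‖) ^ n) y ih
        (continuousOn_const.mul ((continuousOn_integral_norm hT hr).pow n))).trans (le_of_eq ?_)
      rw [← integral_mul_primitive_pow hr.norm y.2, ← intervalIntegral.integral_const_mul]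
      congr 1
      ext t
      ring
    refine (norm_volterra_apply_le hT (intervalIntegrable_one T) (volterra hT r hr g)
      (b := fun y => ‖f‖ * T ^ n / n.factorial *
        ((∫ t in (0 : ℝ)..y, ‖r t‖) ^ (n + 1) / (n + 1))) x h1 ?_).trans ?_
    · exact continuousOn_const.mul (((continuousOn_integral_norm hT hr).pow _).div_const _)
    -- The outer integration is bounded crudely by length times endpoint value. The inner one alone
    -- gains `1/(n+1)`, and a single factorial suffices.
    · have hmono : ∀ t ∈ Icc 0 (x : ℝ), ‖(1 : ℂ)‖ * (‖f‖ * T ^ n / n.factorial *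
          ((∫ t in (0 : ℝ)..t, ‖r t‖) ^ (n + 1) / (n + 1))) ≤ ‖f‖ * T ^ n / n.factorial *
          ((∫ t in (0 : ℝ)..x, ‖r t‖) ^ (n + 1) / (n + 1)) := by
        intro t ht
        rw [norm_one, one_mul]
        have hxx := hr.of_mem_Icc ⟨le_rfl, hT⟩ x.2
        have h2 : (∫ t in (0 : ℝ)..t, ‖r t‖) ≤ ∫ t in (0 : ℝ)..x, ‖r t‖ :=
          integral_norm_mono hxx ht
        have h3 : 0 ≤ ∫ t in (0 : ℝ)..t, ‖r t‖ :=
          intervalIntegral.integral_nonneg ht.1 fun _ _ => norm_nonneg _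
        gcongr
      refine (intervalIntegral.integral_mono_on x.2.1 ?_ intervalIntegrable_const hmono).trans ?_
      · refine ContinuousOn.intervalIntegrable ?_
        have := (continuousOn_integral_norm hT hr).mono
          (uIcc_subset_Icc_of_mem ⟨le_rfl, hT⟩ x.2)
        exact continuousOn_const.mul (continuousOn_const.mul ((this.pow _).div_const _))
      · rw [intervalIntegral.integral_const, smul_eq_mul, sub_zero, Nat.factorial_succ]
        have h3 : 0 ≤ ∫ t in (0 : ℝ)..x, ‖r t‖ :=
          intervalIntegral.integral_nonneg x.2.1 fun _ _ => norm_nonneg _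
        have hC : 0 ≤ ‖f‖ * T ^ n / n.factorial *
          ((∫ t in (0 : ℝ)..x, ‖r t‖) ^ (n + 1) / (n + 1)) := by positivity
        refine (mul_le_mul_of_nonneg_right x.2.2 hC).trans (le_of_eq ?_)
        push_cast
        field_simp
        ring

/-- `1 - x` divides `1 - xⁿ` through the finite geometric sum, which commutes with it, and commuting
factors of a unit are units. -/
theorem isUnit_one_sub_of_norm_pow_lt_one {R : Type*} [NormedRing R] [HasSummableGeomSeries R]
    {x : R} {n : ℕ} (h : ‖x ^ n‖ < 1) : IsUnit (1 - x) := by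
  have h1 : IsUnit (1 - x ^ n) := isUnit_one_sub_of_norm_lt_one h
  have h2 : (1 - x) * (∑ i ∈ Finset.range n, x ^ i) = 1 - x ^ n := mul_neg_geom_sum x n
  have h3 : Commute (1 - x) (∑ i ∈ Finset.range n, x ^ i) :=
    Commute.sum_right _ _ _ fun i _ => (Commute.one_left _).sub_left (Commute.self_pow x i)
  rw [← h2] at h1
  exact (h3.isUnit_mul_iff.mp h1).1

/-- Factorial decay makes some power of the operator a contraction, so no smallness of `r` or `T` is
required. -/
theorem isUnit_one_sub_volterra {T : ℝ} (hT : 0 ≤ T) {r : ℝ → ℂ}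
    (hr : IntervalIntegrable r volume 0 T) :
    IsUnit (1 - volterra hT _ (intervalIntegrable_one T) * volterra hT r hr) := by
  set K := volterra hT _ (intervalIntegrable_one T) * volterra hT r hr with hK
  set M := ∫ t in (0 : ℝ)..T, ‖r t‖
  have hM : 0 ≤ M := intervalIntegral.integral_nonneg hT fun _ _ => norm_nonneg _
  have hb : ∀ n : ℕ, ‖K ^ n‖ ≤ (T * M) ^ n / n.factorial := by
    intro n
    refine ContinuousLinearMap.opNorm_le_bound _ (by positivity) fun f => ?_
    rw [ContinuousMap.norm_le _ (by positivity)]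
    intro x
    refine (norm_volterra_pow_apply_le hT hr n f x).trans ?_
    have h2 : (∫ t in (0 : ℝ)..x, ‖r t‖) ≤ M := integral_norm_mono hr x.2
    have h3 : 0 ≤ ∫ t in (0 : ℝ)..x, ‖r t‖ :=
      intervalIntegral.integral_nonneg x.2.1 fun _ _ => norm_nonneg _
    calc _ ≤ ‖f‖ * T ^ n / n.factorial * M ^ n := by gcongr
      _ = _ := by rw [mul_pow]; ring
  obtain ⟨n, hn⟩ := ((FloorSemiring.tendsto_pow_div_factorial_atTop (T * M)).eventually
    (gt_mem_nhds one_pos)).exists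
  exact isUnit_one_sub_of_norm_pow_lt_one (x := K) ((hb n).trans_lt hn)

/-! ### The Cauchy problem: uniqueness, existence, analyticity in the spectral parameter. -/

/-- The potential `Q` for which the pencil equation reads `y'' = Q y`. -/
def pencilPotential (p q : ℝ → ℂ) (z : ℂ) (x : ℝ) : ℂ := q x + (2 * z) * p x + (-z ^ 2) * 1

theorem intervalIntegrable_pencilPotential {T : ℝ} {p q : ℝ → ℂ}
    (hp : IntervalIntegrable p volume 0 T) (hq : IntervalIntegrable q volume 0 T) (z : ℂ) :
    IntervalIntegrable (pencilPotential p q z) volume 0 T :=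
  (hq.add (hp.const_mul _)).add ((intervalIntegrable_one T).const_mul _)

/-- This exhibits the operator as a polynomial in `z`, the source of all analyticity. The factor `*
1` in `pencilPotential` matches the operator with kernel 1. -/
theorem volterra_pencilPotential {T : ℝ} (hT : 0 ≤ T) {p q : ℝ → ℂ}
    (hp : IntervalIntegrable p volume 0 T) (hq : IntervalIntegrable q volume 0 T) (z : ℂ) :
    volterra hT _ (intervalIntegrable_pencilPotential hp hq z) =
      volterra hT q hq + (2 * z) • volterra hT p hp +
        (-z ^ 2) • volterra hT _ (intervalIntegrable_one T) := by
  ext f x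
  have h0 : (0 : ℝ) ∈ Icc 0 T := ⟨le_rfl, hT⟩
  have hf : Continuous fun t => f (projIcc 0 T hT t) := f.continuous.comp continuous_projIcc
  have i1 := (hq.mul_continuousOn hf.continuousOn).of_mem_Icc h0 x.2
  have i2 := ((hp.mul_continuousOn hf.continuousOn).of_mem_Icc h0 x.2).const_mul (2 * z)
  have i3 := (((intervalIntegrable_one T).mul_continuousOn hf.continuousOn).of_mem_Icc h0
    x.2).const_mul (-z ^ 2)
  simp only [add_apply, ContinuousMap.add_apply, smul_apply,
    ContinuousMap.smul_apply, volterra_apply, smul_eq_mul]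
  rw [← intervalIntegral.integral_const_mul, ← intervalIntegral.integral_const_mul,
    ← intervalIntegral.integral_add i1 i2, ← intervalIntegral.integral_add (i1.add i2) i3]
  congr 1
  ext t
  simp only [pencilPotential]
  ring

/-- The Cauchy data `α + β x` as an element of `C([0, T], ℂ)`. -/
def affineData (T : ℝ) (α β : ℂ) : C(Icc (0 : ℝ) T, ℂ) :=
  ⟨fun x => α + β * ((x : ℝ) : ℂ), by fun_prop⟩

namespace IsPencilSolution

variable {T : ℝ} {p q : ℝ → ℂ} {z : ℂ} {y dy : ℝ → ℂ}

theorem ae_hasDerivAt (h : IsPencilSolution T p q z y dy) :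
    ∀ᵐ x, x ∈ Icc 0 T → HasDerivAt dy (pencilPotential p q z x * y x) x := by
  have h1 := h.equation
  rw [ae_restrict_iff' measurableSet_Ioo] at h1
  have h2 : ∀ᵐ x : ℝ, x ≠ 0 := by simp [ae_iff, measure_singleton]
  have h3 : ∀ᵐ x : ℝ, x ≠ T := by simp [ae_iff, measure_singleton]
  filter_upwards [h1, h2, h3] with x h4 h5 h6 h7
  obtain ⟨d, hd, he⟩ := h4 ⟨lt_of_le_of_ne h7.1 (Ne.symm h5), lt_of_le_of_ne h7.2 h6⟩
  convert hd using 1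
  rw [pencilPotential]
  linear_combination -he

theorem continuousOn (h : IsPencilSolution T p q z y dy) : ContinuousOn y (Icc 0 T) :=
  fun x hx => (h.hasDeriv x hx).continuousWithinAt

theorem continuousOn_deriv (hT : 0 ≤ T) (h : IsPencilSolution T p q z y dy) :
    ContinuousOn dy (Icc 0 T) := by
  have := h.absCont.continuousOn
  rwa [uIcc_of_le hT] at this

theorem absolutelyContinuous (hT : 0 ≤ T) (h : IsPencilSolution T p q z y dy) :
    AbsolutelyContinuousOnInterval y 0 T := by
  refine absolutelyContinuousOnInterval_of_hasDerivWithinAt (f' := dy) ?_ ?_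
  · rw [uIcc_of_le hT]; exact h.hasDeriv
  · rw [uIcc_of_le hT]; exact h.continuousOn_deriv hT

theorem integral_deriv (hT : 0 ≤ T) (h : IsPencilSolution T p q z y dy) {s x : ℝ}
    (hs : s ∈ Icc 0 T) (hx : x ∈ Icc 0 T) : ∫ t in s..x, dy t = y x - y s := by
  rw [← uIcc_of_le hT] at hs hx
  refine (h.absolutelyContinuous hT).integral_eq_sub_of_ae_hasDerivAt
    h.absCont.continuousOn.intervalIntegrable ?_ hs hx
  have h2 : ∀ᵐ x : ℝ, x ≠ 0 := by simp [ae_iff, measure_singleton]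
  have h3 : ∀ᵐ x : ℝ, x ≠ T := by simp [ae_iff, measure_singleton]
  filter_upwards [h2, h3] with x h5 h6 h7
  rw [uIcc_of_le hT] at h7
  exact (h.hasDeriv x h7).hasDerivAt
    (Icc_mem_nhds (lt_of_le_of_ne h7.1 (Ne.symm h5)) (lt_of_le_of_ne h7.2 h6))

theorem integral_potential_mul (hT : 0 ≤ T) (hp : IntervalIntegrable p volume 0 T)
    (hq : IntervalIntegrable q volume 0 T) (h : IsPencilSolution T p q z y dy) {s x : ℝ}
    (hs : s ∈ Icc 0 T) (hx : x ∈ Icc 0 T) :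
    ∫ t in s..x, pencilPotential p q z t * y t = dy x - dy s := by
  have h1 := h.ae_hasDerivAt
  have h2 := h.continuousOn
  rw [← uIcc_of_le hT] at hs hx h1 h2
  exact h.absCont.integral_eq_sub_of_ae_hasDerivAt
    ((intervalIntegrable_pencilPotential hp hq z).mul_continuousOn h2) h1 hs hx

/-- Integrating `y'' = Q y` twice turns the Cauchy problem into an equation for `y` alone, to which
invertibility of `1 - V₁ V_Q` applies. -/
theorem volterra_eq (hT : 0 ≤ T) (hp : IntervalIntegrable p volume 0 T)
    (hq : IntervalIntegrable q volume 0 T) (h : IsPencilSolution T p q z y dy)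
    {f : C(Icc (0 : ℝ) T, ℂ)} (hf : ∀ x : Icc (0 : ℝ) T, f x = y x) :
    (1 - volterra hT _ (intervalIntegrable_one T) *
      volterra hT _ (intervalIntegrable_pencilPotential hp hq z)) f =
      affineData T (y 0) (dy 0) := by
  have h0 : (0 : ℝ) ∈ Icc 0 T := ⟨le_rfl, hT⟩
  have e1 : ∀ x : Icc (0 : ℝ) T,
      volterra hT _ (intervalIntegrable_pencilPotential hp hq z) f x = dy x - dy 0 := by
    intro x
    rw [← h.integral_potential_mul hT hp hq h0 x.2, volterra_apply]
    refine intervalIntegral.integral_congr fun t ht => ?_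
    have ht' : t ∈ Icc 0 T := uIcc_subset_Icc_of_mem h0 x.2 ht
    simp only [projIcc_of_mem hT ht', hf]
  ext x
  have e2 : volterra hT _ (intervalIntegrable_one T)
      (volterra hT _ (intervalIntegrable_pencilPotential hp hq z) f) x =
      y x - y 0 - dy 0 * ((x : ℝ) : ℂ) := by
    rw [← h.integral_deriv hT h0 x.2, volterra_apply]
    have : ∫ t in (0 : ℝ)..x, dy 0 = dy 0 * ((x : ℝ) : ℂ) := by
      simp [mul_comm]
    rw [← this, ← intervalIntegral.integral_sub _ intervalIntegrable_const]
    · refine intervalIntegral.integral_congr fun t ht => ?_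
      have ht' : t ∈ Icc 0 T := uIcc_subset_Icc_of_mem h0 x.2 ht
      simp only [projIcc_of_mem hT ht', e1, one_mul]
    · exact ((h.continuousOn_deriv hT).mono (uIcc_subset_Icc_of_mem h0 x.2)).intervalIntegrable
  change f x - volterra hT _ (intervalIntegrable_one T)
      (volterra hT _ (intervalIntegrable_pencilPotential hp hq z) f) x = y 0 + dy 0 * ((x : ℝ) : ℂ)
  rw [e2, hf]
  ring

theorem eq_of_initial (hT : 0 < T) (hp : IntervalIntegrable p volume 0 T)
    (hq : IntervalIntegrable q volume 0 T) (h : IsPencilSolution T p q z y dy) {w dw : ℝ → ℂ}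
    (h' : IsPencilSolution T p q z w dw) (e : y 0 = w 0) (e' : dy 0 = dw 0) :
    ∀ x ∈ Icc 0 T, y x = w x ∧ dy x = dw x := by
  have key : ∀ x ∈ Icc 0 T, y x = w x := by
    intro x hx
    let f : C(Icc (0 : ℝ) T, ℂ) := ⟨_, continuousOn_iff_continuous_domRestrict.mp h.continuousOn⟩
    let g : C(Icc (0 : ℝ) T, ℂ) := ⟨_, continuousOn_iff_continuous_domRestrict.mp h'.continuousOn⟩
    have h1 := h.volterra_eq hT.le hp hq (f := f) fun _ => rfl
    have h2 := h'.volterra_eq hT.le hp hq (f := g) fun _ => rfl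
    rw [e, e', ← h2] at h1
    obtain ⟨u, hu⟩ := isUnit_one_sub_volterra hT.le (intervalIntegrable_pencilPotential hp hq z)
    have h3 : f = g := by
      rw [← hu] at h1
      have h4 := congrArg (u.inv) h1
      have h5 : ∀ a : C(Icc (0 : ℝ) T, ℂ), u.inv (u.val a) = a := fun a => by
        rw [← mul_apply_eq_comp, u.inv_val, one_apply_eq_self]
      rwa [h5, h5] at h4
    exact DFunLike.congr_fun h3 ⟨x, hx⟩
  refine fun x hx => ⟨key x hx, ?_⟩
  exact ((uniqueDiffOn_Icc hT) x hx).eq_deriv _ (h.hasDeriv x hx)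
    ((h'.hasDeriv x hx).congr key (key x hx))

end IsPencilSolution

theorem differentiable_inverse_one_sub_mul_apply {E : Type*} [NormedAddCommGroup E]
    [NormedSpace ℂ E] [CompleteSpace E] (V : E →L[ℂ] E) {W : ℂ → E →L[ℂ] E}
    (hW : Differentiable ℂ W) (hu : ∀ z, IsUnit (1 - V * W z)) (g : E) :
    Differentiable ℂ fun z => Ring.inverse (1 - V * W z) g := by
  intro z
  have h1 : DifferentiableAt ℂ (fun z => 1 - V * W z) z := ((hW z).const_mul V).const_sub _
  have h2 : DifferentiableAt ℂ (fun z => Ring.inverse (1 - V * W z)) z :=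
    DifferentiableAt.comp (g := Ring.inverse) z (differentiableAt_inverse (hu z)) h1
  exact h2.clm_apply (differentiableAt_const _)

theorem differentiable_quadratic_family {E : Type*} [NormedAddCommGroup E]
    [NormedSpace ℂ E] (A B C : E →L[ℂ] E) :
    Differentiable ℂ fun z : ℂ => A + (2 * z) • B + (-z ^ 2) • C := by
  have h1 : Differentiable ℂ fun z : ℂ => 2 * z := by fun_prop
  have h2 : Differentiable ℂ fun z : ℂ => -z ^ 2 := by fun_prop
  exact ((h1.smul_const B).const_add _).fun_add (h2.smul_const _)

/-- Existence of solutions, depending analytically on the spectral parameter. -/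
theorem exists_isPencilSolution_differentiable {T : ℝ} (hT : 0 < T) {p q : ℝ → ℂ}
    (hp : IntervalIntegrable p volume 0 T) (hq : IntervalIntegrable q volume 0 T) (α β : ℂ) :
    ∃ y dy : ℝ → ℂ → ℂ, (∀ z, IsPencilSolution T p q z (y · z) (dy · z) ∧ y 0 z = α ∧ dy 0 z = β) ∧
      ∀ x ∈ Icc 0 T, Differentiable ℂ (y x) ∧ Differentiable ℂ (dy x) := by
  have h0 : (0 : ℝ) ∈ Icc 0 T := ⟨le_rfl, hT.le⟩
  let V1 := volterra hT.le _ (intervalIntegrable_one T)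
  let VQ : ℂ → (C(Icc (0 : ℝ) T, ℂ) →L[ℂ] C(Icc (0 : ℝ) T, ℂ)) := fun z =>
    volterra hT.le _ (intervalIntegrable_pencilPotential hp hq z)
  have hVQ : Differentiable ℂ VQ := by
    have : VQ = fun z => volterra hT.le q hq + (2 * z) • volterra hT.le p hp +
        (-z ^ 2) • volterra hT.le _ (intervalIntegrable_one T) :=
      funext fun z => volterra_pencilPotential hT.le hp hq z
    rw [this]
    exact differentiable_quadratic_family _ _ _
  have hunit : ∀ z, IsUnit (1 - V1 * VQ z) := fun z => isUnit_one_sub_volterra hT.le _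
  -- The inverse is holomorphic in `z`, since ring inversion is differentiable at units.
  let Y : ℂ → C(Icc (0 : ℝ) T, ℂ) := fun z => (Ring.inverse (1 - V1 * VQ z)) (affineData T α β)
  have hY : Differentiable ℂ Y := differentiable_inverse_one_sub_mul_apply V1 hVQ hunit _
  have hYeq : ∀ z, Y z = affineData T α β + V1 (VQ z (Y z)) := by
    intro z
    have h1 : ((1 - V1 * VQ z) * Ring.inverse (1 - V1 * VQ z)) (affineData T α β)
        = affineData T α β := by
      rw [Ring.mul_inverse_cancel _ (hunit z)]; rfl
    have h2 : Y z - V1 (VQ z (Y z)) = affineData T α β := h1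
    rw [← h2]; abel
  let DY : ℂ → C(Icc (0 : ℝ) T, ℂ) := fun z => VQ z (Y z)
  have hDY : Differentiable ℂ DY := fun z => (hVQ z).clm_apply (hY z)
  -- `projIcc` extends `Y z` constantly outside `[0, T]`; those values never matter.
  let y : ℝ → ℂ → ℂ := fun x z => Y z (projIcc 0 T hT.le x)
  let dy : ℝ → ℂ → ℂ := fun x z => β + ∫ t in (0 : ℝ)..x, pencilPotential p q z t * y t z
  have hyc : ∀ z, Continuous (y · z) := fun z => (Y z).continuous.comp continuous_projIcc
  have hint : ∀ z, IntervalIntegrable (fun t => pencilPotential p q z t * y t z) volume 0 T :=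
    fun z => (intervalIntegrable_pencilPotential hp hq z).mul_continuousOn (hyc z).continuousOn
  have hdy : ∀ z, ∀ x (hx : x ∈ Icc 0 T), dy x z = β + DY z ⟨x, hx⟩ := fun z x hx => rfl
  have hyy : ∀ z, ∀ x ∈ Icc 0 T, y x z = α + ∫ t in (0 : ℝ)..x, dy t z := by
    intro z x hx
    have h1 : y x z = Y z ⟨x, hx⟩ := by simp only [y, projIcc_of_mem hT.le hx]
    have h2 : ∫ t in (0 : ℝ)..x, dy t z = β * x + V1 (DY z) ⟨x, hx⟩ := by
      have h3 : ∫ t in (0 : ℝ)..x, β = β * (x : ℂ) := by simp [mul_comm]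
      rw [← h3]
      simp only [V1, volterra_apply]
      rw [← intervalIntegral.integral_add intervalIntegrable_const]
      · refine intervalIntegral.integral_congr fun t ht => ?_
        have ht' : t ∈ Icc 0 T := uIcc_subset_Icc_of_mem h0 hx ht
        simp only [hdy z t ht', projIcc_of_mem hT.le ht', one_mul]
      · exact (continuous_const.mul
          ((DY z).continuous.comp continuous_projIcc)).intervalIntegrable _ _
    rw [h1, h2, hYeq z]
    change α + β * (x : ℂ) + _ = _
    rw [add_assoc]
  have hdac : ∀ z, AbsolutelyContinuousOnInterval (dy · z) 0 T := by
    intro z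
    refine AbsolutelyContinuousOnInterval.fun_add ?_
      ((hint z).absolutelyContinuousOnInterval_complex left_mem_uIcc)
    exact (LipschitzWith.const β).lipschitzOnWith.absolutelyContinuousOnInterval
  have hdc : ∀ z, ContinuousOn (dy · z) (Icc 0 T) := fun z => by
    have := (hdac z).continuousOn
    rwa [uIcc_of_le hT.le] at this
  refine ⟨y, dy, fun z => ⟨⟨fun x hx => ?_, hdac z, ?_⟩, ?_, ?_⟩, fun x hx => ⟨?_, ?_⟩⟩
  · refine HasDerivWithinAt.congr ?_ (hyy z) (hyy z x hx)
    exact (hasDerivWithinAt_integral_of_continuousOn (hdc z) h0 hx).const_add α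
  · rw [ae_restrict_iff' measurableSet_Ioo]
    filter_upwards [(hint z).ae_hasDerivAt_integral] with x h1 h2
    refine ⟨_, (h1 (by rw [uIcc_of_le hT.le]; exact Ioo_subset_Icc_self h2) 0
      left_mem_uIcc).const_add β, ?_⟩
    simp only [pencilPotential]
    ring
  · rw [hyy z 0 h0]; simp
  · simp [dy]
  · exact (ContinuousMap.evalCLM ℂ (projIcc 0 T hT.le x)).differentiable.comp hY
  · have : dy x = fun z => β + DY z ⟨x, hx⟩ := funext fun z => hdy z x hx
    rw [this]
    exact ((ContinuousMap.evalCLM ℂ (⟨x, hx⟩ : Icc (0 : ℝ) T)).differentiable.comp hDY).const_add β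

namespace IsPencilSolution

variable {T : ℝ} {p q : ℝ → ℂ} {z : ℂ} {y dy : ℝ → ℂ}

/-- The equation has no first-derivative term, so the Wronskian has zero derivative almost
everywhere, and absolute continuity makes it constant. -/
theorem wronskian_eq (hT : 0 ≤ T) (h : IsPencilSolution T p q z y dy) {w dw : ℝ → ℂ}
    (h' : IsPencilSolution T p q z w dw) {s x : ℝ} (hs : s ∈ Icc 0 T) (hx : x ∈ Icc 0 T) :
    y x * dw x - dy x * w x = y s * dw s - dy s * w s := by
  have hac := ((h.absolutelyContinuous hT).complex_mul h'.absCont).fun_sub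
    (h.absCont.complex_mul (h'.absolutelyContinuous hT))
  have h2 : ∀ᵐ x : ℝ, x ≠ 0 := by simp [ae_iff, measure_singleton]
  have h3 : ∀ᵐ x : ℝ, x ≠ T := by simp [ae_iff, measure_singleton]
  obtain ⟨C, hC⟩ := hac.const_of_ae_hasDerivAt_zero (by
    filter_upwards [h.ae_hasDerivAt, h'.ae_hasDerivAt, h2, h3] with t ht ht' h5 h6 h7
    rw [uIcc_of_le hT] at h7
    have hn : Icc 0 T ∈ nhds t :=
      Icc_mem_nhds (lt_of_le_of_ne h7.1 (Ne.symm h5)) (lt_of_le_of_ne h7.2 h6)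
    refine ((((h.hasDeriv t h7).hasDerivAt hn).mul (ht' h7)).sub
      ((ht h7).mul ((h'.hasDeriv t h7).hasDerivAt hn))).congr_deriv ?_
    ring)
  rw [uIcc_of_le hT] at hC
  rw [hC x hx, hC s hs]

end IsPencilSolution

/-! ### Asymptotics for large spectral parameter. -/

/-- The phase `z (x - s) - ∫ₛˣ p` of the solutions of the pencil equation. -/
noncomputable def pencilPhase (p : ℝ → ℂ) (z : ℂ) (s x : ℝ) : ℂ := z * ((x : ℂ) - s) - ∫ t in s..x, p t

/-- A complex `p` changes the exponentials only by a factor bounded uniformly in `z`. -/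
theorem abs_im_pencilPhase_le {T : ℝ} {p : ℝ → ℂ} (hp : IntervalIntegrable p volume 0 T) (z : ℂ)
    {s x : ℝ} (hs : s ∈ Icc 0 T) (hx : x ∈ Icc 0 T) :
    |(pencilPhase p z s x).im| ≤ |z.im| * |x - s| + ∫ t in (0 : ℝ)..T, ‖p t‖ := by
  have h1 : ‖∫ t in s..x, p t‖ ≤ ∫ t in (0 : ℝ)..T, ‖p t‖ := by
    refine intervalIntegral.norm_integral_le_abs_integral_norm.trans ?_
    have hT := hs.1.trans hs.2
    refine (intervalIntegral.abs_integral_mono_interval (c := 0) (d := T) ?_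
      (Filter.Eventually.of_forall fun _ => norm_nonneg _) hp.norm).trans (le_of_eq ?_)
    · exact uIoc_subset_uIoc_of_uIcc_subset_uIcc
        ((uIcc_subset_Icc_of_mem hs hx).trans Icc_subset_uIcc)
    · exact abs_of_nonneg (intervalIntegral.integral_nonneg hT fun _ _ => norm_nonneg _)
  have h2 : (pencilPhase p z s x).im = z.im * (x - s) - (∫ t in s..x, p t).im := by
    simp [pencilPhase, ← Complex.ofReal_sub]
  rw [h2]
  calc _ ≤ |z.im * (x - s)| + |(∫ t in s..x, p t).im| := abs_sub _ _
    _ ≤ _ := by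
      rw [abs_mul]
      gcongr
      exact (Complex.abs_im_le_norm _).trans h1

/-- Variation of constants for the first order factor `y' - κ (z - p) y`, where `κ = ±i`. -/
theorem IsPencilSolution.factor_eq {T : ℝ} (hT : 0 ≤ T) {p q : ℝ → ℂ} {z : ℂ} {y dy : ℝ → ℂ}
    (hp : AbsolutelyContinuousOnInterval p 0 T) (hq : IntervalIntegrable q volume 0 T)
    (h : IsPencilSolution T p q z y dy) {κ : ℂ} (hκ : κ ^ 2 = -1) {s x : ℝ}
    (hs : s ∈ Icc 0 T) (hx : x ∈ Icc 0 T) :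
    dy x - κ * (z - p x) * y x - Complex.exp (-κ * pencilPhase p z s x) *
      (dy s - κ * (z - p s) * y s) =
    ∫ t in s..x, Complex.exp (-κ * pencilPhase p z t x) *
      ((p t ^ 2 + q t + κ * deriv p t) * y t) := by
  have hpc : ContinuousOn p (Icc 0 T) := by
    have := hp.continuousOn
    rwa [uIcc_of_le hT] at this
  have hexp : ∀ t ∈ Icc 0 T, HasDerivWithinAt
      (fun t => Complex.exp (-κ * pencilPhase p z t x))
      (Complex.exp (-κ * pencilPhase p z t x) * (κ * (z - p t))) (Icc 0 T) t := by
    intro t ht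
    have h1 := hasDerivWithinAt_integral_of_continuousOn hpc hx ht
    have h2 : HasDerivWithinAt (fun t : ℝ => (t : ℂ)) 1 (Icc 0 T) t :=
      Complex.ofRealCLM.hasDerivWithinAt
    have h3 := ((((h2.const_sub (x : ℂ)).const_mul z).add h1).const_mul (-κ)).cexp
    have e : ∀ t, pencilPhase p z t x = z * ((x : ℂ) - t) + ∫ v in x..t, p v := by
      intro t
      rw [pencilPhase, intervalIntegral.integral_symm]
      ring
    simp only [e]
    refine h3.congr_deriv ?_
    simp only [Pi.add_apply]
    ring
  have hexpc : ContinuousOn (fun t => Complex.exp (-κ * pencilPhase p z t x)) (Icc 0 T) :=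
    fun t ht => (hexp t ht).continuousWithinAt
  have hI : uIcc 0 T = Icc 0 T := uIcc_of_le hT
  have hac1 : AbsolutelyContinuousOnInterval
      (fun t => Complex.exp (-κ * pencilPhase p z t x)) 0 T := by
    refine absolutelyContinuousOnInterval_of_hasDerivWithinAt
      (f' := fun t => Complex.exp (-κ * pencilPhase p z t x) * (κ * (z - p t))) ?_ ?_
    · rw [hI]; exact hexp
    · rw [hI]
      exact hexpc.mul (continuousOn_const.mul (continuousOn_const.sub hpc))
  have hzp : AbsolutelyContinuousOnInterval (fun t => κ * (z - p t)) 0 T := by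
    have hc : AbsolutelyContinuousOnInterval (fun _ : ℝ => z) 0 T :=
      (LipschitzWith.const z).lipschitzOnWith.absolutelyContinuousOnInterval
    exact (hc.fun_sub hp).const_smul κ
  have hac2 : AbsolutelyContinuousOnInterval (fun t => dy t - κ * (z - p t) * y t) 0 T :=
    h.absCont.fun_sub (hzp.complex_mul (h.absolutelyContinuous hT))
  have hac := hac1.complex_mul hac2
  have hpot : IntervalIntegrable (fun t => p t ^ 2 + q t + κ * deriv p t) volume 0 T := by
    refine IntervalIntegrable.add (IntervalIntegrable.add ?_ hq)
      (hp.intervalIntegrable_deriv_complex.const_mul κ)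
    exact (hp.continuousOn.pow 2).intervalIntegrable
  have hy : ContinuousOn y (uIcc 0 T) := by rw [hI]; exact h.continuousOn
  have hint : IntervalIntegrable (fun t => Complex.exp (-κ * pencilPhase p z t x) *
      ((p t ^ 2 + q t + κ * deriv p t) * y t)) volume 0 T := by
    refine IntervalIntegrable.continuousOn_mul (hpot.mul_continuousOn hy) ?_
    rw [hI]; exact hexpc
  have hs' := hs
  have hx' := hx
  rw [← hI] at hs' hx'
  rw [hac.integral_eq_sub_of_ae_hasDerivAt hint ?_ hs' hx']
  · simp [pencilPhase]
  · have h2 : ∀ᵐ x : ℝ, x ≠ 0 := by simp [ae_iff, measure_singleton]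
    have h3 : ∀ᵐ x : ℝ, x ≠ T := by simp [ae_iff, measure_singleton]
    -- For `w = y' - κ(z - p)y`, the identity `κ² = -1` cancels every power of `z` and leaves `w' +
    -- κ(z - p)w = (p² + q + κp')y`. The derivative of `p` is why `p` is taken absolutely
    -- continuous.
    filter_upwards [h.ae_hasDerivAt, hp.ae_hasDerivAt_complex, h2, h3] with t ht hpt h5 h6 h7
    have hpt := hpt h7
    rw [hI] at h7
    have hn : Icc 0 T ∈ nhds t :=
      Icc_mem_nhds (lt_of_le_of_ne h7.1 (Ne.symm h5)) (lt_of_le_of_ne h7.2 h6)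
    have d1 := (hexp t h7).hasDerivAt hn
    have d2 := (h.hasDeriv t h7).hasDerivAt hn
    refine (d1.mul ((ht h7).sub (((hpt.const_sub z).const_mul κ).mul d2))).congr_deriv ?_
    simp only [pencilPotential, Pi.mul_apply, Pi.sub_apply]
    linear_combination (-Complex.exp (-κ * pencilPhase p z t x) * (z - p t) ^ 2 * y t) * hκ

theorem norm_exp_mul_le_of_sq_eq_neg_one {κ : ℂ} (hκ : κ ^ 2 = -1) (w : ℂ) :
    ‖Complex.exp (κ * w)‖ ≤ Real.exp |w.im| := by
  rw [Complex.norm_exp, Real.exp_le_exp]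
  have h1 : (κ - Complex.I) * (κ + Complex.I) = 0 := by
    linear_combination hκ - Complex.I_sq
  rcases mul_eq_zero.mp h1 with h2 | h2
  · rw [sub_eq_zero.mp h2]
    simpa using neg_le_abs _
  · rw [eq_neg_of_add_eq_zero_left h2]
    simpa using le_abs_self _

theorem norm_sin_le_exp (w : ℂ) : ‖Complex.sin w‖ ≤ Real.exp |w.im| := by
  have h1 := norm_exp_mul_le_of_sq_eq_neg_one Complex.I_sq w
  have h2 := norm_exp_mul_le_of_sq_eq_neg_one (κ := -Complex.I) (by simp) w
  rw [Complex.sin, show -w * Complex.I = -Complex.I * w by ring, mul_comm w, norm_div, norm_mul,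
    Complex.norm_I, mul_one, Complex.norm_ofNat, div_le_iff₀ two_pos]
  calc _ ≤ ‖Complex.exp (-Complex.I * w)‖ + ‖Complex.exp (Complex.I * w)‖ := norm_sub_le _ _
    _ ≤ _ := by linarith

theorem norm_cos_le_exp (w : ℂ) : ‖Complex.cos w‖ ≤ Real.exp |w.im| := by
  have h1 := norm_exp_mul_le_of_sq_eq_neg_one Complex.I_sq w
  have h2 := norm_exp_mul_le_of_sq_eq_neg_one (κ := -Complex.I) (by simp) w
  rw [Complex.cos, show -w * Complex.I = -Complex.I * w by ring, mul_comm w, norm_div,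
    Complex.norm_ofNat, div_le_iff₀ two_pos]
  calc _ ≤ ‖Complex.exp (Complex.I * w)‖ + ‖Complex.exp (-Complex.I * w)‖ := norm_add_le _ _
    _ ≤ _ := by linarith

/-- The first order factors of a solution deviate from pure exponentials by a small amount for
large spectral parameters. -/
theorem exists_factor_asymptotics {T : ℝ} (hT : 0 ≤ T) {p q : ℝ → ℂ}
    (hp : AbsolutelyContinuousOnInterval p 0 T) (hq : IntervalIntegrable q volume 0 T) :
    ∃ C R : ℝ, 0 < C ∧ 0 < R ∧ (∀ x ∈ Icc 0 T, ‖p x‖ ≤ R / 2) ∧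
      ∀ z : ℂ, R ≤ ‖z‖ → ∀ y dy, IsPencilSolution T p q z y dy →
      ∀ s ∈ Icc 0 T, ∀ x ∈ Icc 0 T, ∀ κ : ℂ, κ ^ 2 = -1 →
      ‖dy x - κ * (z - p x) * y x - Complex.exp (-κ * pencilPhase p z s x) *
      (dy s - κ * (z - p s) * y s)‖ ≤ C / ‖z‖ * Real.exp (|z.im| * |x - s|) *
      (‖dy s - Complex.I * (z - p s) * y s‖ + ‖dy s - (-Complex.I) * (z - p s) * y s‖) := by
  have hI : uIcc 0 T = Icc 0 T := uIcc_of_le hT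
  have hpc : ContinuousOn p (Icc 0 T) := hI ▸ hp.continuousOn
  have hpi : IntervalIntegrable p volume 0 T := hp.continuousOn.intervalIntegrable
  obtain ⟨B, hB⟩ := isCompact_Icc.exists_bound_of_continuousOn hpc
  have hB0 : 0 ≤ B := (norm_nonneg _).trans (hB 0 ⟨le_rfl, hT⟩)
  set P := ∫ t in (0 : ℝ)..T, ‖p t‖ with hP
  let r : ℝ → ℝ := fun t => ‖p t ^ 2 + q t‖ + ‖deriv p t‖
  have hr : IntervalIntegrable r volume 0 T :=
    ((hp.continuousOn.pow 2).intervalIntegrable.add hq).norm.add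
      hp.intervalIntegrable_deriv_complex.norm
  have hr0 : ∀ t, 0 ≤ r t := fun t => by positivity
  set ρ := ∫ t in (0 : ℝ)..T, r t with hρ
  have hρ0 : 0 ≤ ρ := intervalIntegral.integral_nonneg hT fun t _ => hr0 t
  -- The threshold gives `‖z - p‖ ≥ ‖z‖/2` and makes the coefficient of `M` in the bound for `M`
  -- itself at most `1/2`, so that term is absorbed on the left.
  refine ⟨2 * Real.exp P * Real.exp P * (ρ + 1), 2 * B + 4 * Real.exp P * (ρ + 1), by positivity,
    by positivity, fun x hx => (hB x hx).trans ?_, ?_⟩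
  · have : 0 ≤ 4 * Real.exp P * (ρ + 1) := by positivity
    linarith
  intro z hz y dy h s hs
  have hpos : 0 < 4 * Real.exp P * (ρ + 1) := by positivity
  have hz0 : 0 < ‖z‖ := by linarith
  have hκI : Complex.I ^ 2 = -1 := Complex.I_sq
  have hκI' : (-Complex.I) ^ 2 = -1 := by simp
  let w : ℂ → ℝ → ℂ := fun κ x => dy x - κ * (z - p x) * y x
  let S : ℝ := ‖w Complex.I s‖ + ‖w (-Complex.I) s‖
  -- The weight removes the expected exponential growth. The maximum of `N` bounds `y` too, as the
  -- two factors differ by `2i(z - p)y`, and this yields the gain `1/‖z‖`.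
  let N : ℝ → ℝ := fun x => (‖w Complex.I x‖ + ‖w (-Complex.I) x‖) * Real.exp (-(|z.im| * |x - s|))
  have hwc : ∀ κ, ContinuousOn (w κ) (Icc 0 T) := fun κ =>
    (h.continuousOn_deriv hT).sub ((continuousOn_const.mul (continuousOn_const.sub hpc)).mul
      h.continuousOn)
  have hNc : ContinuousOn N (Icc 0 T) :=
    ((hwc _).norm.add (hwc _).norm).mul (Continuous.continuousOn (by fun_prop))
  obtain ⟨x₀, hx₀, hmax⟩ := isCompact_Icc.exists_isMaxOn ⟨s, hs⟩ hNc
  set M := N x₀ with hM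
  have hM0 : 0 ≤ M := by positivity
  have hyb : ∀ t ∈ Icc 0 T, ‖y t‖ ≤ M * Real.exp (|z.im| * |t - s|) / ‖z‖ := by
    intro t ht
    have h1 : w (-Complex.I) t - w Complex.I t = 2 * Complex.I * (z - p t) * y t := by
      simp only [w]; ring
    have h2 : ‖z‖ / 2 ≤ ‖z - p t‖ := by
      have h3 := norm_sub_norm_le z (p t)
      have h4 := hB t ht
      linarith
    have h5 : 2 * ‖z - p t‖ * ‖y t‖ ≤ ‖w Complex.I t‖ + ‖w (-Complex.I) t‖ := by
      have := norm_sub_le (w (-Complex.I) t) (w Complex.I t)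
      rw [h1, norm_mul, norm_mul, norm_mul, Complex.norm_I, Complex.norm_ofNat] at this
      linarith
    have h6 : ‖w Complex.I t‖ + ‖w (-Complex.I) t‖ ≤ M * Real.exp (|z.im| * |t - s|) := by
      have h7 : N t ≤ M := hmax ht
      have h8 : N t * Real.exp (|z.im| * |t - s|) = ‖w Complex.I t‖ + ‖w (-Complex.I) t‖ := by
        simp only [N]
        rw [mul_assoc, ← Real.exp_add, neg_add_cancel, Real.exp_zero, mul_one]
      rw [← h8]
      gcongr
    rw [le_div_iff₀ hz0]
    nlinarith [norm_nonneg (y t)]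
  have main : ∀ x ∈ Icc 0 T, ∀ κ : ℂ, κ ^ 2 = -1 →
      ‖w κ x - Complex.exp (-κ * pencilPhase p z s x) * w κ s‖ ≤
        Real.exp P * ρ / ‖z‖ * M * Real.exp (|z.im| * |x - s|) := by
    intro x hx κ hκ
    have hκn : ‖κ‖ = 1 := by
      have := congrArg norm hκ
      rw [norm_pow, norm_neg, norm_one] at this
      exact (pow_eq_one_iff_of_nonneg (norm_nonneg _) two_ne_zero).mp this
    rw [show w κ x - Complex.exp (-κ * pencilPhase p z s x) * w κ s = _ from
      h.factor_eq hT hp hq hκ hs hx]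
    have hb : ∀ t ∈ uIcc s x, ‖Complex.exp (-κ * pencilPhase p z t x) *
        ((p t ^ 2 + q t + κ * deriv p t) * y t)‖ ≤
        Real.exp P / ‖z‖ * M * Real.exp (|z.im| * |x - s|) * r t := by
      intro t ht
      have ht' := uIcc_subset_Icc_of_mem hs hx ht
      have h1 : ‖Complex.exp (-κ * pencilPhase p z t x)‖ ≤
          Real.exp (|z.im| * |x - t| + P) :=
        (norm_exp_mul_le_of_sq_eq_neg_one (by rw [neg_sq, hκ]) _).trans
          (Real.exp_le_exp.mpr (abs_im_pencilPhase_le hpi z ht' hx))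
      have h2 : ‖p t ^ 2 + q t + κ * deriv p t‖ ≤ r t := by
        refine (norm_add_le _ _).trans ?_
        rw [norm_mul, hκn, one_mul]
      have h3 : |x - t| + |t - s| = |x - s| := by
        rcases le_total s x with hsx | hsx
        · rw [uIcc_of_le hsx] at ht
          rw [abs_of_nonneg (by linarith [ht.2]), abs_of_nonneg (by linarith [ht.1]),
            abs_of_nonneg (by linarith)]
          ring
        · rw [uIcc_of_ge hsx] at ht
          rw [abs_of_nonpos (by linarith [ht.1]), abs_of_nonpos (by linarith [ht.2]),
            abs_of_nonpos (by linarith)]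
          ring
      rw [norm_mul, norm_mul]
      calc _ ≤ Real.exp (|z.im| * |x - t| + P) *
          (r t * (M * Real.exp (|z.im| * |t - s|) / ‖z‖)) := by
            gcongr
            exact hyb t ht'
        _ = _ := by
          rw [← h3, Real.exp_add, mul_add |z.im|, Real.exp_add]
          ring
    have hb' := fun t (ht : t ∈ uIoc s x) => hb t (uIoc_subset_uIcc ht)
    refine (intervalIntegral.norm_integral_le_abs_of_norm_le
      (ae_restrict_of_forall_mem measurableSet_uIoc hb') ((hr.of_mem_Icc hs hx).const_mul _)).trans ?_
    rw [intervalIntegral.integral_const_mul, abs_mul, abs_of_nonneg (by positivity)]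
    have : |∫ t in s..x, r t| ≤ ρ := by
      refine (intervalIntegral.abs_integral_mono_interval (c := 0) (d := T) ?_
        (Filter.Eventually.of_forall hr0) hr).trans (le_of_eq (abs_of_nonneg hρ0))
      exact uIoc_subset_uIoc_of_uIcc_subset_uIcc
        ((uIcc_subset_Icc_of_mem hs hx).trans Icc_subset_uIcc)
    calc _ ≤ Real.exp P / ‖z‖ * M * Real.exp (|z.im| * |x - s|) * ρ := by gcongr
      _ = _ := by ring
  have hMb : M ≤ 2 * Real.exp P * S := by
    have hw : ∀ κ : ℂ, κ ^ 2 = -1 → ‖w κ x₀‖ ≤ Real.exp (|z.im| * |x₀ - s|) *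
        (Real.exp P * ‖w κ s‖ + Real.exp P * ρ / ‖z‖ * M) := by
      intro κ hκ
      have h1 := main x₀ hx₀ κ hκ
      have h2 : ‖Complex.exp (-κ * pencilPhase p z s x₀)‖ ≤
          Real.exp (|z.im| * |x₀ - s| + P) :=
        (norm_exp_mul_le_of_sq_eq_neg_one (by rw [neg_sq, hκ]) _).trans
          (Real.exp_le_exp.mpr (abs_im_pencilPhase_le hpi z hs hx₀))
      have h3 := norm_sub_norm_le (w κ x₀) (Complex.exp (-κ * pencilPhase p z s x₀) * w κ s)
      rw [norm_mul] at h3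
      have h4 : ‖Complex.exp (-κ * pencilPhase p z s x₀)‖ * ‖w κ s‖ ≤
          Real.exp (|z.im| * |x₀ - s| + P) * ‖w κ s‖ := by gcongr
      rw [Real.exp_add] at h4
      linarith
    have h1 := add_le_add (hw _ hκI) (hw _ hκI')
    have h2 : M ≤ Real.exp P * S + 2 * (Real.exp P * ρ / ‖z‖) * M := by
      have h3 : M * Real.exp (|z.im| * |x₀ - s|) = ‖w Complex.I x₀‖ + ‖w (-Complex.I) x₀‖ := by
        simp only [hM, N]
        rw [mul_assoc, ← Real.exp_add, neg_add_cancel, Real.exp_zero, mul_one]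
      rw [← h3, ← mul_add, mul_comm] at h1
      have := le_of_mul_le_mul_left h1 (Real.exp_pos _)
      simp only [S]
      linarith
    have h4 : 2 * (Real.exp P * ρ / ‖z‖) ≤ 1 / 2 := by
      rw [mul_div_assoc', div_le_iff₀ hz0]
      nlinarith [Real.exp_pos P]
    nlinarith
  intro x hx κ hκ
  refine (main x hx κ hκ).trans ?_
  have hS0 : 0 ≤ S := by positivity
  calc _ ≤ Real.exp P * ρ / ‖z‖ * (2 * Real.exp P * S) * Real.exp (|z.im| * |x - s|) := by gcongr
    _ ≤ Real.exp P * (ρ + 1) / ‖z‖ * (2 * Real.exp P * S) * Real.exp (|z.im| * |x - s|) := by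
      gcongr; linarith
    _ = _ := by simp only [S, w]; ring

/-- Asymptotics of the solution vanishing at `s` with unit slope. -/
theorem exists_sine_asymptotics {T : ℝ} (hT : 0 ≤ T) {p q : ℝ → ℂ}
    (hp : AbsolutelyContinuousOnInterval p 0 T) (hq : IntervalIntegrable q volume 0 T) :
    ∃ C R : ℝ, 0 < C ∧ 0 < R ∧
      ∀ z : ℂ, R ≤ ‖z‖ → ∀ y dy, IsPencilSolution T p q z y dy →
      ∀ s ∈ Icc 0 T, y s = 0 → dy s = 1 → ∀ x ∈ Icc 0 T,
      ‖z * y x - Complex.sin (pencilPhase p z s x)‖ ≤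
        C / ‖z‖ * Real.exp (|z.im| * |x - s|) ∧
      ‖dy x - Complex.cos (pencilPhase p z s x)‖ ≤
        C / ‖z‖ * Real.exp (|z.im| * |x - s|) := by
  obtain ⟨C, R, hC, hR, hpR, H⟩ := exists_factor_asymptotics hT hp hq
  have hpi : IntervalIntegrable p volume 0 T := hp.continuousOn.intervalIntegrable
  set P := ∫ t in (0 : ℝ)..T, ‖p t‖ with hP
  refine ⟨2 * C + (Real.exp P + 2 * C / R) * R, R, by positivity, hR,
    fun z hz y dy h s hs hys hdys x hx => ?_⟩
  have hz0 : 0 < ‖z‖ := hR.trans_le hz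
  have h1 := H z hz y dy h s hs x hx Complex.I Complex.I_sq
  have h2 := H z hz y dy h s hs x hx (-Complex.I) (by simp)
  simp only [hys, hdys, mul_zero, sub_zero, norm_one, mul_one] at h1 h2
  set θ := pencilPhase p z s x with hθ
  set E := Real.exp (|z.im| * |x - s|) with hE
  have hE0 : 0 < E := Real.exp_pos _
  set A := dy x - Complex.I * (z - p x) * y x - Complex.exp (-Complex.I * θ) with hA
  set B := dy x - -Complex.I * (z - p x) * y x - Complex.exp (- -Complex.I * θ) with hB
  -- The half-sum and half-difference of the factors for `κ = ±i` recover `y'` and `(z - p)y`.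
  -- Replacing `z - p` by `z` below costs only `O(1/‖z‖)`.
  have hcos : dy x - Complex.cos θ = (A + B) / 2 := by
    rw [hA, hB, Complex.cos, show -θ * Complex.I = -Complex.I * θ by ring, mul_comm θ, neg_neg]
    ring
  have hsin : (z - p x) * y x - Complex.sin θ = (A - B) * Complex.I / 2 := by
    rw [hA, hB, Complex.sin, show -θ * Complex.I = -Complex.I * θ by ring, mul_comm θ, neg_neg]
    linear_combination ((z - p x) * y x) * Complex.I_sq
  have hAB : ‖A‖ + ‖B‖ ≤ 2 * (2 * C / ‖z‖ * E) := by
    have : C / ‖z‖ * E * (1 + 1) = 2 * C / ‖z‖ * E := by ring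
    rw [this] at h1 h2
    linarith
  have hcos' : ‖dy x - Complex.cos θ‖ ≤ 2 * C / ‖z‖ * E := by
    rw [hcos, norm_div, Complex.norm_ofNat, div_le_iff₀ two_pos]
    linarith [norm_add_le A B]
  have hsin' : ‖(z - p x) * y x - Complex.sin θ‖ ≤ 2 * C / ‖z‖ * E := by
    rw [hsin, norm_div, norm_mul, Complex.norm_I, mul_one, Complex.norm_ofNat,
      div_le_iff₀ two_pos]
    linarith [norm_sub_le A B]
  have hsn : ‖Complex.sin θ‖ ≤ Real.exp P * E := by
    refine (norm_sin_le_exp θ).trans ?_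
    rw [← Real.exp_add, Real.exp_le_exp, add_comm]
    exact abs_im_pencilPhase_le hpi z hs hx
  have hyb : ‖y x‖ ≤ 2 * (Real.exp P + 2 * C / R) * E / ‖z‖ := by
    have h3 : ‖z‖ / 2 ≤ ‖z - p x‖ := by
      have h3 := norm_sub_norm_le z (p x)
      have h4 := hpR x hx
      linarith
    have h5 : ‖(z - p x) * y x‖ ≤ (Real.exp P + 2 * C / R) * E := by
      have h6 := norm_sub_norm_le ((z - p x) * y x) (Complex.sin θ)
      have h7 : 2 * C / ‖z‖ * E ≤ 2 * C / R * E := by gcongr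
      linarith
    rw [norm_mul] at h5
    rw [le_div_iff₀ hz0]
    nlinarith [norm_nonneg (y x)]
  refine ⟨?_, hcos'.trans ?_⟩
  · have e : z * y x - Complex.sin θ = ((z - p x) * y x - Complex.sin θ) + p x * y x := by ring
    rw [e]
    refine (norm_add_le _ _).trans ?_
    have h8 : ‖p x * y x‖ ≤ R / 2 * (2 * (Real.exp P + 2 * C / R) * E / ‖z‖) := by
      rw [norm_mul]
      have := hpR x hx
      gcongr
    calc _ ≤ 2 * C / ‖z‖ * E + R / 2 * (2 * (Real.exp P + 2 * C / R) * E / ‖z‖) :=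
          add_le_add hsin' h8
      _ = _ := by ring
  · gcongr
    have : 0 ≤ (Real.exp P + 2 * C / R) * R := by positivity
    linarith

/-! ### Entire functions of sine type and their quotients. -/

/-- An entire function of sine type: `z D(z) = sin (z ℓ - ω) + O(exp (|Im z| |ℓ|) / |z|)`. -/
structure IsSineType (D : ℂ → ℂ) (ℓ : ℝ) (ω : ℂ) : Prop where
  differentiable : Differentiable ℂ D
  asymptotics : ∃ C R : ℝ, 0 < C ∧ 0 < R ∧ ∀ z : ℂ, R ≤ ‖z‖ →
    ‖z * D z - Complex.sin (z * ℓ - ω)‖ ≤ C / ‖z‖ * Real.exp (|z.im| * |ℓ|)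

theorem Complex.norm_sin_sq (w : ℂ) :
    ‖Complex.sin w‖ ^ 2 = Real.cosh w.im ^ 2 - Real.cos w.re ^ 2 := by
  have h : Complex.sin w = ((Real.sin w.re * Real.cosh w.im : ℝ) : ℂ) +
      ((Real.cos w.re * Real.sinh w.im : ℝ) : ℂ) * Complex.I := by
    rw [Complex.sin_eq]; push_cast; ring
  rw [h, Complex.norm_add_mul_I, Real.sq_sqrt (by positivity)]
  have h1 := Real.sin_sq_add_cos_sq w.re
  have h2 := Real.cosh_sq w.im
  rw [mul_pow, mul_pow, Real.sin_sq, h2]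
  ring

/-- By `|sin w|² = cosh²(Im w) - cos²(Re w)`, the sine is small only near its zeros; both
alternatives stay away from them. -/
theorem Complex.exp_abs_im_div_four_le_norm_sin {w : ℂ} (hw : Real.cos w.re = 0 ∨ 1 ≤ |w.im|) :
    Real.exp |w.im| / 4 ≤ ‖Complex.sin w‖ := by
  refine le_of_sq_le_sq ?_ (norm_nonneg _)
  rw [Complex.norm_sin_sq]
  have hcosh : Real.cosh w.im = (Real.exp |w.im| + Real.exp (-|w.im|)) / 2 := by
    rw [← Real.cosh_abs, Real.cosh_eq]
  have hprod : Real.exp |w.im| * Real.exp (-|w.im|) = 1 := by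
    rw [← Real.exp_add]; simp
  set E := Real.exp |w.im|
  set F := Real.exp (-|w.im|)
  have hE : 0 < E := Real.exp_pos _
  have hF : 0 < F := Real.exp_pos _
  rw [hcosh]
  rcases hw with h | h
  · rw [h]; nlinarith
  · have h1 : 2 ≤ E := by
      have := Real.add_one_le_exp |w.im|
      linarith
    have := Real.cos_sq_le_one w.re
    nlinarith

namespace IsSineType

variable {D : ℂ → ℂ} {ℓ : ℝ} {ω : ℂ}

/-- Where the sine has full exponential size it dominates the error term, so `D` has a lower bound
of the same order as the upper bound on `D r`. -/
theorem exists_norm_le_of_mul_le (hD : IsSineType D ℓ ω) {r : ℂ → ℂ} {K R₀ : ℝ}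
    (hK : ∀ z, R₀ ≤ ‖z‖ → ‖D z * r z‖ ≤ K / ‖z‖ * Real.exp (|z.im| * |ℓ|)) :
    ∃ M R₁ : ℝ, ∀ z : ℂ, R₁ ≤ ‖z‖ →
      (Real.cos (z * ℓ - ω).re = 0 ∨ 1 ≤ |(z * ℓ - ω).im|) → ‖r z‖ ≤ M := by
  obtain ⟨C, R, hC, hR, H⟩ := hD.asymptotics
  set c := Real.exp (-|ω.im|) / 4 with hc
  have hc0 : 0 < c := by positivity
  refine ⟨2 * K / c, max (max R R₀) (2 * C / c), fun z hz hgood => ?_⟩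
  have hz1 : R ≤ ‖z‖ := (le_max_left _ _).trans ((le_max_left _ _).trans hz)
  have hz2 : R₀ ≤ ‖z‖ := (le_max_right _ _).trans ((le_max_left _ _).trans hz)
  have hz3 : 2 * C / c ≤ ‖z‖ := (le_max_right _ _).trans hz
  have hz0 : 0 < ‖z‖ := hR.trans_le hz1
  have h1 := Complex.exp_abs_im_div_four_le_norm_sin hgood
  have h2 : |z.im| * |ℓ| - |ω.im| ≤ |(z * ℓ - ω).im| := by
    have : (z * ℓ - ω).im = z.im * ℓ - ω.im := by simp
    rw [this, ← abs_mul]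
    exact abs_sub_abs_le_abs_sub _ _
  set E := Real.exp (|z.im| * |ℓ|) with hE
  have hE0 : 0 < E := Real.exp_pos _
  have h3 : c * E ≤ ‖Complex.sin (z * ℓ - ω)‖ := by
    refine le_trans ?_ h1
    have : c * E = Real.exp (|z.im| * |ℓ| - |ω.im|) / 4 := by
      rw [hc, hE, sub_eq_add_neg, Real.exp_add]; ring
    rw [this]
    have := Real.exp_le_exp.mpr h2
    linarith
  have h4 := H z hz1
  have h5 : C / ‖z‖ * E ≤ c / 2 * E := by
    refine mul_le_mul_of_nonneg_right ?_ hE0.le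
    rw [div_le_iff₀ hz0]
    rw [div_le_iff₀ hc0] at hz3
    linarith
  have h6 : c / 2 * E ≤ ‖z‖ * ‖D z‖ := by
    have := norm_sub_norm_le (Complex.sin (z * ℓ - ω)) (z * D z)
    rw [norm_sub_rev, norm_mul] at this
    linarith
  have h7 := hK z hz2
  rw [norm_mul] at h7
  have h8 : ‖z‖ * ‖D z‖ * ‖r z‖ ≤ K * E := by
    calc _ = ‖z‖ * (‖D z‖ * ‖r z‖) := by ring
      _ ≤ ‖z‖ * (K / ‖z‖ * E) := by gcongr
      _ = _ := by field_simp
  rw [le_div_iff₀ hc0]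
  have h9 : c / 2 * E * ‖r z‖ ≤ K * E := (by gcongr : _ ≤ _).trans h8
  nlinarith

/-- An entire function that is a quotient of comparable functions of sine type is constant. -/
theorem eq_const_of_mul_le (hD : IsSineType D ℓ ω) (hℓ : ℓ ≠ 0) {r : ℂ → ℂ}
    (hr : Differentiable ℂ r) {K R₀ : ℝ}
    (hK : ∀ z, R₀ ≤ ‖z‖ → ‖D z * r z‖ ≤ K / ‖z‖ * Real.exp (|z.im| * |ℓ|)) (z z' : ℂ) :
    r z = r z' := by
  obtain ⟨M, R₁, hM⟩ := hD.exists_norm_le_of_mul_le hK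
  have hℓ' : (ℓ : ℂ) ≠ 0 := by exact_mod_cast hℓ
  let g : ℂ → ℂ := fun w => r ((w + ω) / ℓ)
  have hg : Differentiable ℂ g := hr.comp (by fun_prop)
  have bound : ∀ w, ‖g w‖ ≤ M := by
    intro w
    obtain ⟨n, hn⟩ := exists_nat_ge (‖w‖ + ‖ω‖ + |R₁| * |ℓ| + 1)
    -- In the variable `w = zℓ - ω`, the square of half-side `L` has cosine zero on its vertical
    -- sides and `|Im w| ≥ 1` on its horizontal ones. The maximum principle carries the bound
    -- inside.
    set L : ℝ := Real.pi / 2 + n * Real.pi with hL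
    have hLn : (n : ℝ) < L := by
      have h1 := Real.pi_gt_three
      have h2 : (0 : ℝ) ≤ n := n.cast_nonneg
      nlinarith
    have hpos1 := norm_nonneg w
    have hpos2 := norm_nonneg ω
    have hpos3 : 0 ≤ |R₁| * |ℓ| := by positivity
    have hL1 : 1 ≤ L := by linarith
    have hcosL : Real.cos L = 0 := by
      rw [Real.cos_eq_zero_iff]
      exact ⟨n, by rw [hL]; push_cast; ring⟩
    have hwL : ‖w‖ < L := by linarith
    refine Complex.norm_le_of_forall_mem_frontier_norm_le (U := Ioo (-L) L ×ℂ Ioo (-L) L)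
      ((Metric.isBounded_Ioo _ _).reProdIm (Metric.isBounded_Ioo _ _)) hg.diffContOnCl ?_
      (subset_closure ?_)
    · intro v hv
      rw [Complex.frontier_reProdIm, frontier_Ioo (by linarith), closure_Ioo (by linarith)] at hv
      have hv' : |v.re| = L ∨ |v.im| = L := by
        rcases hv with h | h
        · right
          rcases h.2 with h | h
          · rw [h, abs_neg, abs_of_nonneg (by linarith)]
          · rw [mem_singleton_iff.mp h, abs_of_nonneg (by linarith)]
        · left
          rcases h.1 with h | h
          · rw [h, abs_neg, abs_of_nonneg (by linarith)]
          · rw [mem_singleton_iff.mp h, abs_of_nonneg (by linarith)]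
      have hvL : L ≤ ‖v‖ := by
        rcases hv' with h | h
        · rw [← h]; exact Complex.abs_re_le_norm v
        · rw [← h]; exact Complex.abs_im_le_norm v
      have he : (v + ω) / ℓ * ℓ - ω = v := by field_simp; ring
      refine hM _ ?_ ?_
      · rw [norm_div, Complex.norm_real, Real.norm_eq_abs, le_div_iff₀ (abs_pos.mpr hℓ)]
        have h1 : R₁ * |ℓ| ≤ |R₁| * |ℓ| := by gcongr; exact le_abs_self _
        have h2 := norm_sub_norm_le v (-ω)
        rw [norm_neg, sub_neg_eq_add] at h2
        linarith
      · rw [he]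
        rcases hv' with h | h
        · left; rw [← Real.cos_abs, h, hcosL]
        · right; rw [h]; exact hL1
    · have h1 := (Complex.abs_re_le_norm w).trans_lt hwL
      have h2 := (Complex.abs_im_le_norm w).trans_lt hwL
      exact ⟨abs_lt.mp h1, abs_lt.mp h2⟩
  refine hr.apply_eq_apply_of_bounded ?_ z z'
  refine (Metric.isBounded_closedBall (x := (0 : ℂ)) (r := M)).subset ?_
  rintro _ ⟨u, rfl⟩
  have := bound (u * ℓ - ω)
  simp only [g] at this
  rw [show (u * ℓ - ω + ω) / ℓ = u by field_simp; ring] at this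
  simpa using this

/-- On an imaginary half-axis one of the two exponentials in the sine dominates, so the limit reads
the phase `ω` off `D`. Both signs `κ = ±i` are used later. -/
theorem tendsto_exp_mul (hD : IsSineType D ℓ ω) (hℓ : ℓ ≠ 0) {κ : ℂ} (hκ : κ ^ 2 = -1) :
    Filter.Tendsto (fun τ : ℝ => (Real.exp (-τ) : ℂ) * (κ * τ / ℓ * D (κ * τ / ℓ)))
      Filter.atTop (nhds (κ / 2 * Complex.exp (κ * ω))) := by
  obtain ⟨C, R, hC, hR, H⟩ := hD.asymptotics
  have hℓ' : (ℓ : ℂ) ≠ 0 := by exact_mod_cast hℓ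
  have hℓa : 0 < |ℓ| := abs_pos.mpr hℓ
  have hκn : ‖κ‖ = 1 := by
    have := congrArg norm hκ
    rw [norm_pow, norm_neg, norm_one] at this
    exact (pow_eq_one_iff_of_nonneg (norm_nonneg _) two_ne_zero).mp this
  have hκsin : ∀ w, Complex.sin w = κ / 2 * (Complex.exp (-κ * w) - Complex.exp (κ * w)) := by
    intro w
    have h1 : (κ - Complex.I) * (κ + Complex.I) = 0 := by
      linear_combination hκ - Complex.I_sq
    rw [Complex.sin]
    rcases mul_eq_zero.mp h1 with h2 | h2
    · rw [sub_eq_zero.mp h2, show -w * Complex.I = -Complex.I * w by ring, mul_comm w]; ring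
    · rw [eq_neg_of_add_eq_zero_left h2, neg_neg, show -w * Complex.I = -Complex.I * w by ring,
        mul_comm w]
      ring
  have hκim : |κ.im| ≤ 1 := hκn ▸ Complex.abs_im_le_norm κ
  have h1 : Filter.Tendsto (fun τ : ℝ => (Real.exp (-τ) : ℂ) * Complex.sin (κ * τ / ℓ * ℓ - ω))
      Filter.atTop (nhds (κ / 2 * Complex.exp (κ * ω))) := by
    have h2 : ∀ τ : ℝ, (Real.exp (-τ) : ℂ) * Complex.sin (κ * τ / ℓ * ℓ - ω) =
        κ / 2 * Complex.exp (κ * ω) -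
        κ / 2 * Complex.exp (-κ * ω) * ((Real.exp (-2 * τ) : ℝ) : ℂ) := by
      intro τ
      rw [div_mul_cancel₀ _ hℓ', hκsin]
      have e1 : Complex.exp (-κ * (κ * τ - ω)) = Complex.exp τ * Complex.exp (κ * ω) := by
        rw [← Complex.exp_add]; congr 1; linear_combination (-(τ : ℂ)) * hκ
      have e2 : Complex.exp (κ * (κ * τ - ω)) = Complex.exp (-τ) * Complex.exp (-κ * ω) := by
        rw [← Complex.exp_add]; congr 1; linear_combination (τ : ℂ) * hκ
      have e3 : Complex.exp (-2 * τ) = Complex.exp (-τ) * Complex.exp (-τ) := by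
        rw [← Complex.exp_add]; congr 1; ring
      have e4 : Complex.exp (-τ) * Complex.exp τ = 1 := by
        rw [← Complex.exp_add]; simp
      rw [e1, e2]
      push_cast
      rw [e3]
      linear_combination (κ / 2 * Complex.exp (κ * ω)) * e4
    simp only [h2]
    have h3 : Filter.Tendsto (fun τ : ℝ => Real.exp (-2 * τ)) Filter.atTop (nhds 0) :=
      Real.tendsto_exp_atBot.comp (Filter.tendsto_id.const_mul_atTop_of_neg (by norm_num))
    have h4 := ((Complex.continuous_ofReal.tendsto 0).comp h3).const_mul
      (κ / 2 * Complex.exp (-κ * ω))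
    have h5 := h4.const_sub (κ / 2 * Complex.exp (κ * ω))
    simpa using! h5
  have h6 : Filter.Tendsto (fun τ : ℝ => (Real.exp (-τ) : ℂ) * (κ * τ / ℓ * D (κ * τ / ℓ)) -
      (Real.exp (-τ) : ℂ) * Complex.sin (κ * τ / ℓ * ℓ - ω)) Filter.atTop (nhds 0) := by
    have h7 : Filter.Tendsto (fun τ : ℝ => C * |ℓ| / τ) Filter.atTop (nhds 0) :=
      tendsto_const_nhds.div_atTop Filter.tendsto_id
    refine squeeze_zero_norm' ?_ h7
    filter_upwards [Filter.eventually_ge_atTop (R * |ℓ|), Filter.eventually_gt_atTop 0]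
      with τ hτ hτ0
    have hzn : ‖κ * τ / ℓ‖ = τ / |ℓ| := by
      rw [norm_div, norm_mul, hκn, one_mul, Complex.norm_real, Complex.norm_real,
        Real.norm_eq_abs, Real.norm_eq_abs, abs_of_pos hτ0]
    have h8 := H (κ * τ / ℓ) (by rwa [hzn, le_div_iff₀ hℓa])
    have him : |(κ * τ / ℓ).im| * |ℓ| ≤ τ := by
      have : κ * τ / ℓ = κ * ((τ / ℓ : ℝ) : ℂ) := by push_cast; ring
      rw [this, Complex.im_mul_ofReal, abs_mul, abs_div, mul_assoc, div_mul_cancel₀ _ hℓa.ne',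
        abs_of_pos hτ0]
      nlinarith
    rw [← mul_sub, norm_mul, Complex.norm_real, Real.norm_eq_abs, abs_of_pos (Real.exp_pos _)]
    rw [hzn] at h8
    calc _ ≤ Real.exp (-τ) * (C / (τ / |ℓ|) * Real.exp τ) := by
          refine mul_le_mul_of_nonneg_left (h8.trans ?_) (Real.exp_pos _).le
          have : 0 ≤ C / (τ / |ℓ|) := by positivity
          gcongr
      _ = C * |ℓ| / τ * (Real.exp (-τ) * Real.exp τ) := by field_simp
      _ = _ := by rw [← Real.exp_add]; simp
  simpa using h6.add h1

theorem exists_ne_zero (hD : IsSineType D ℓ ω) (hℓ : ℓ ≠ 0) : ∃ z, D z ≠ 0 := by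
  by_contra! h
  have h1 := hD.tendsto_exp_mul hℓ Complex.I_sq
  simp only [h, mul_zero] at h1
  have := tendsto_nhds_unique h1 tendsto_const_nhds
  simp [Complex.exp_ne_zero] at this

theorem exp_eq_of_eq_const_mul (hD : IsSineType D ℓ ω) (hℓ : ℓ ≠ 0) {D' : ℂ → ℂ} {ω' c : ℂ}
    (hD' : IsSineType D' ℓ ω') (h : ∀ z, D' z = c * D z) {κ : ℂ} (hκ : κ ^ 2 = -1) :
    Complex.exp (κ * ω') = c * Complex.exp (κ * ω) := by
  have h1 := (hD.tendsto_exp_mul hℓ hκ).const_mul c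
  have h2 := hD'.tendsto_exp_mul hℓ hκ
  have h3 := tendsto_nhds_unique h2 (h1.congr fun τ => by rw [h]; ring)
  have hκ0 : κ ≠ 0 := by rintro rfl; norm_num at hκ
  have h4 : κ / 2 ≠ 0 := by simpa using hκ0
  exact mul_left_cancel₀ h4 (by rw [h3]; ring)

/-- The quotient is constant by the Liouville argument. The extra `1/‖z‖` sends its product with the
limit along the imaginary half-axis to zero, while that limit is nonzero. -/
theorem eq_zero_of_mul_le (hD : IsSineType D ℓ ω) (hℓ : ℓ ≠ 0) {r : ℂ → ℂ}
    (hr : Differentiable ℂ r) {K R₀ : ℝ} (hK0 : 0 ≤ K)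
    (hK : ∀ z, R₀ ≤ ‖z‖ → ‖D z * r z‖ ≤ K / ‖z‖ ^ 2 * Real.exp (|z.im| * |ℓ|)) (z : ℂ) :
    r z = 0 := by
  have hconst := fun z => hD.eq_const_of_mul_le hℓ hr (K := K) (R₀ := max R₀ 1) (fun z hz => by
    refine (hK z ((le_max_left _ _).trans hz)).trans ?_
    have h1 : 1 ≤ ‖z‖ := (le_max_right _ _).trans hz
    gcongr
    nlinarith) z 0
  rw [hconst z]
  by_contra h0
  have h1 := (hD.tendsto_exp_mul hℓ Complex.I_sq).mul_const (r 0)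
  have hℓa : 0 < |ℓ| := abs_pos.mpr hℓ
  have h7 : Filter.Tendsto (fun τ : ℝ => K * |ℓ| / τ) Filter.atTop (nhds 0) :=
    tendsto_const_nhds.div_atTop Filter.tendsto_id
  have h2 := squeeze_zero_norm' (f := fun τ : ℝ =>
    (Real.exp (-τ) : ℂ) * (Complex.I * τ / ℓ * D (Complex.I * τ / ℓ)) * r 0) ?_ h7
  · have h3 := tendsto_nhds_unique h1 h2
    simp [Complex.exp_ne_zero, h0] at h3
  · filter_upwards [Filter.eventually_ge_atTop (R₀ * |ℓ|), Filter.eventually_gt_atTop 0]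
      with τ hτ hτ0
    have hzn : ‖Complex.I * τ / ℓ‖ = τ / |ℓ| := by
      rw [norm_div, norm_mul, Complex.norm_I, one_mul, Complex.norm_real, Complex.norm_real,
        Real.norm_eq_abs, Real.norm_eq_abs, abs_of_pos hτ0]
    have h8 := hK (Complex.I * τ / ℓ) (by rwa [hzn, le_div_iff₀ hℓa])
    have him : |(Complex.I * τ / ℓ).im| * |ℓ| = τ := by
      have : Complex.I * τ / ℓ = Complex.I * ((τ / ℓ : ℝ) : ℂ) := by push_cast; ring
      rw [this, Complex.im_mul_ofReal, abs_mul, abs_div, mul_assoc, div_mul_cancel₀ _ hℓa.ne',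
        abs_of_pos hτ0]
      simp
    rw [hconst, him, hzn, norm_mul] at h8
    rw [norm_mul, norm_mul, norm_mul, hzn, Complex.norm_real, Real.norm_eq_abs,
      abs_of_pos (Real.exp_pos _)]
    calc _ = Real.exp (-τ) * (τ / |ℓ|) * (‖D (Complex.I * τ / ℓ)‖ * ‖r 0‖) := by ring
      _ ≤ Real.exp (-τ) * (τ / |ℓ|) * (K / (τ / |ℓ|) ^ 2 * Real.exp τ) := by gcongr
      _ = K * |ℓ| / τ * (Real.exp (-τ) * Real.exp τ) := by field_simp
      _ = _ := by rw [← Real.exp_add]; simp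

end IsSineType

/-- Division of entire functions. -/
theorem exists_differentiable_eq_mul {f g : ℂ → ℂ} (hf : Differentiable ℂ f)
    (hg : Differentiable ℂ g) (hg0 : ∃ z, g z ≠ 0)
    (h : ∀ z, analyticOrderAt g z ≤ analyticOrderAt f z) :
    ∃ r : ℂ → ℂ, Differentiable ℂ r ∧ ∀ z, f z = r z * g z := by
  have hfa : ∀ z, AnalyticAt ℂ f z := fun z => hf.analyticAt z
  have hga : ∀ z, AnalyticAt ℂ g z := fun z => hg.analyticAt z
  have hgne : ∀ z, ∀ᶠ w in nhdsWithin z {z}ᶜ, g w ≠ 0 := by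
    intro z
    rcases (hga z).eventually_eq_zero_or_eventually_ne_zero with h1 | h1
    · exfalso
      obtain ⟨w, hw⟩ := hg0
      have hgo : AnalyticOnNhd ℂ g univ := fun z _ => hga z
      exact hw (congrFun (hgo.eq_of_eventuallyEq (g := 0) (fun _ _ => analyticAt_const) h1) w)
    · exact h1
  have hm : MeromorphicOn (f / g) univ := fun z _ => (hfa z).meromorphicAt.div (hga z).meromorphicAt
  have hord : ∀ z, 0 ≤ meromorphicOrderAt (f / g) z := by
    intro z
    rw [meromorphicOrderAt_div (hfa z).meromorphicAt (hga z).meromorphicAt,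
      (hfa z).meromorphicOrderAt_eq, (hga z).meromorphicOrderAt_eq]
    have h1 : analyticOrderAt g z ≠ ⊤ := by
      intro h2
      rw [analyticOrderAt_eq_top] at h2
      have h3 := (hgne z).and (h2.filter_mono nhdsWithin_le_nhds)
      obtain ⟨w, hw⟩ := h3.exists
      exact hw.1 hw.2
    have h2 := h z
    obtain ⟨n, hn⟩ := ENat.ne_top_iff_exists.mp h1
    rw [← hn] at h2 ⊢
    generalize analyticOrderAt f z = o at h2 ⊢
    induction o using ENat.recTopCoe with
    | top => simp
    | coe m =>
      have : n ≤ m := by exact_mod_cast h2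
      simp only [ENat.map_natCast]
      norm_cast
      omega
  -- The normal form fills in the removable singularities of `f / g`, including its values at the
  -- zeros of `g`.
  let r := toMeromorphicNFOn (f / g) univ
  have hr : ∀ z, AnalyticAt ℂ r z := fun z => by
    refine ((meromorphicNFOn_toMeromorphicNFOn (f / g) univ
      (mem_univ z)).meromorphicOrderAt_nonneg_iff_analyticAt).mp ?_
    rw [meromorphicOrderAt_toMeromorphicNFOn hm (mem_univ z)]
    exact hord z
  refine ⟨r, fun z => (hr z).differentiableAt, fun z => ?_⟩
  have h1 : ∀ᶠ w in nhdsWithin z {z}ᶜ, f w = r w * g w := by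
    filter_upwards [hm.toMeromorphicNFOn_eq_self_on_nhdsNE (mem_univ z), hgne z] with w h2 h3
    simp only [r]
    rw [h2, Pi.div_apply, div_mul_cancel₀ _ h3]
  have h2 : Filter.Tendsto f (nhdsWithin z {z}ᶜ) (nhds (f z)) :=
    (hf z).continuousAt.tendsto.mono_left nhdsWithin_le_nhds
  have h3 : Filter.Tendsto (fun w => r w * g w) (nhdsWithin z {z}ᶜ) (nhds (r z * g z)) :=
    ((hr z).continuousAt.mul (hg z).continuousAt).tendsto.mono_left nhdsWithin_le_nhds
  exact tendsto_nhds_unique (h2.congr' h1) h3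

/-! ### Analytic families of solutions based at an arbitrary point. -/

theorem IsPencilSolution.linear_comb {T : ℝ} {p q : ℝ → ℂ} {z : ℂ} {y dy w dw : ℝ → ℂ}
    (h : IsPencilSolution T p q z y dy) (h' : IsPencilSolution T p q z w dw) (α β : ℂ) :
    IsPencilSolution T p q z (fun x => α * y x + β * w x) (fun x => α * dy x + β * dw x) where
  hasDeriv x hx := ((h.hasDeriv x hx).const_mul α).add ((h'.hasDeriv x hx).const_mul β)
  absCont := (h.absCont.const_smul α).fun_add (h'.absCont.const_smul β)
  equation := by
    filter_upwards [h.equation, h'.equation] with x ⟨d, hd, he⟩ ⟨d', hd', he'⟩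
    refine ⟨_, (hd.const_mul α).add (hd'.const_mul β), ?_⟩
    linear_combination α * he + β * he'

/-- A family of solutions of the pencil equation depending analytically on the spectral
parameter. -/
structure IsPencilFamily (T : ℝ) (p q : ℝ → ℂ) (y dy : ℝ → ℂ → ℂ) : Prop where
  solution : ∀ z, IsPencilSolution T p q z (y · z) (dy · z)
  differentiable : ∀ x ∈ Icc 0 T, Differentiable ℂ (y x)
  differentiable_deriv : ∀ x ∈ Icc 0 T, Differentiable ℂ (dy x)

/-- Cramer's rule moves the Cauchy data from 0 to `s`. The determinant is the Wronskian 1, so the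
coefficients stay entire in `z`. -/
theorem exists_isPencilFamily {T : ℝ} (hT : 0 < T) {p q : ℝ → ℂ}
    (hp : IntervalIntegrable p volume 0 T) (hq : IntervalIntegrable q volume 0 T) {s : ℝ}
    (hs : s ∈ Icc 0 T) (α β : ℂ) :
    ∃ y dy : ℝ → ℂ → ℂ, IsPencilFamily T p q y dy ∧ (∀ z, y s z = α) ∧ ∀ z, dy s z = β := by
  have h0 : (0 : ℝ) ∈ Icc 0 T := ⟨le_rfl, hT.le⟩
  obtain ⟨y, dy, h, hd⟩ := exists_isPencilSolution_differentiable hT hp hq 1 0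
  obtain ⟨w, dw, h', hd'⟩ := exists_isPencilSolution_differentiable hT hp hq 0 1
  have hW : ∀ z, y s z * dw s z - dy s z * w s z = 1 := by
    intro z
    rw [(h z).1.wronskian_eq hT.le (h' z).1 h0 hs, (h z).2.1, (h z).2.2, (h' z).2.1, (h' z).2.2]
    ring
  refine ⟨fun x z => (α * dw s z - β * w s z) * y x z + (β * y s z - α * dy s z) * w x z,
    fun x z => (α * dw s z - β * w s z) * dy x z + (β * y s z - α * dy s z) * dw x z,
    ⟨fun z => (h z).1.linear_comb (h' z).1 _ _, fun x hx => ?_, fun x hx => ?_⟩,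
    fun z => ?_, fun z => ?_⟩
  · have := (hd s hs).1; have := (hd s hs).2; have := (hd' s hs).1; have := (hd' s hs).2
    have := (hd x hx).1; have := (hd' x hx).1
    fun_prop
  · have := (hd s hs).1; have := (hd s hs).2; have := (hd' s hs).1; have := (hd' s hs).2
    have := (hd x hx).2; have := (hd' x hx).2
    fun_prop
  · linear_combination α * hW z
  · linear_combination β * hW z

theorem IsPencilFamily.isSineType {T : ℝ} (hT : 0 ≤ T) {p q : ℝ → ℂ} {y dy : ℝ → ℂ → ℂ}
    (hp : AbsolutelyContinuousOnInterval p 0 T) (hq : IntervalIntegrable q volume 0 T)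
    (h : IsPencilFamily T p q y dy) {s x : ℝ} (hs : s ∈ Icc 0 T) (hx : x ∈ Icc 0 T)
    (hy : ∀ z, y s z = 0) (hdy : ∀ z, dy s z = 1) :
    IsSineType (y x) (x - s) (∫ t in s..x, p t) := by
  obtain ⟨C, R, hC, hR, H⟩ := exists_sine_asymptotics hT hp hq
  refine ⟨h.differentiable x hx, C, R, hC, hR, fun z hz => ?_⟩
  have := (H z hz _ _ (h.solution z) s hs (hy z) (hdy z) x hx).1
  rw [pencilPhase] at this
  push_cast
  exact this

theorem exists_growth_bound {T : ℝ} (hT : 0 ≤ T) {p q : ℝ → ℂ}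
    (hp : AbsolutelyContinuousOnInterval p 0 T) (hq : IntervalIntegrable q volume 0 T) :
    ∃ K R : ℝ, 0 < K ∧ 0 < R ∧
      ∀ z : ℂ, R ≤ ‖z‖ → ∀ y dy, IsPencilSolution T p q z y dy →
      ∀ s ∈ Icc 0 T, y s = 0 → dy s = 1 → ∀ x ∈ Icc 0 T,
      ‖y x‖ ≤ K / ‖z‖ * Real.exp (|z.im| * |x - s|) ∧
      ‖dy x‖ ≤ K * Real.exp (|z.im| * |x - s|) := by
  obtain ⟨C, R, hC, hR, H⟩ := exists_sine_asymptotics hT hp hq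
  have hpi : IntervalIntegrable p volume 0 T := hp.continuousOn.intervalIntegrable
  set P := ∫ t in (0 : ℝ)..T, ‖p t‖ with hP
  refine ⟨C / R + Real.exp P, R, by positivity, hR, fun z hz y dy h s hs hy hdy x hx => ?_⟩
  obtain ⟨h1, h2⟩ := H z hz y dy h s hs hy hdy x hx
  have hz0 : 0 < ‖z‖ := hR.trans_le hz
  set E := Real.exp (|z.im| * |x - s|) with hE
  have hE0 : 0 < E := Real.exp_pos _
  have h3 : Real.exp |(pencilPhase p z s x).im| ≤ Real.exp P * E := by
    rw [← Real.exp_add, Real.exp_le_exp, add_comm]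
    exact abs_im_pencilPhase_le hpi z hs hx
  have h4 := (norm_sin_le_exp (pencilPhase p z s x)).trans h3
  have h5 := (norm_cos_le_exp (pencilPhase p z s x)).trans h3
  have h6 : C / ‖z‖ * E ≤ C / R * E := by gcongr
  have h7 := norm_sub_norm_le (z * y x) (Complex.sin (pencilPhase p z s x))
  have h8 := norm_sub_norm_le (dy x) (Complex.cos (pencilPhase p z s x))
  rw [norm_mul] at h7
  constructor
  · rw [div_mul_eq_mul_div, le_div_iff₀ hz0]
    linarith
  · linarith

/-! ### From Weyl data modulo an entire function to the coefficients. -/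

/-- Two pencils with the same Weyl data on the segment between `e` and `a`, in the form of values
and slopes at `a` of the solutions vanishing at `e`, have the same coefficients there. -/
theorem coefficients_eq_of_weyl_eq {T : ℝ} (hT : 0 < T) {p q p' q' : ℝ → ℂ}
    (hp : AbsolutelyContinuousOnInterval p 0 T) (hq : IntervalIntegrable q volume 0 T)
    (hp' : AbsolutelyContinuousOnInterval p' 0 T) (hq' : IntervalIntegrable q' volume 0 T)
    {e a : ℝ} (he : e ∈ Icc 0 T) (ha : a ∈ Icc 0 T) (hea : e ≠ a)
    {S dS S' dS' : ℝ → ℂ → ℂ} (hS : IsPencilFamily T p q S dS)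
    (hS' : IsPencilFamily T p' q' S' dS') (hSe : ∀ z, S e z = 0) (hdSe : ∀ z, dS e z = 1)
    (hSe' : ∀ z, S' e z = 0) (hdSe' : ∀ z, dS' e z = 1)
    {ε : ℂ} (hε : ε ^ 2 = 1) (hval : ∀ z, S' a z = ε * S a z)
    {F : ℂ → ℂ} (hF : Differentiable ℂ F) (hslope : ∀ z, ε * dS' a z - dS a z = F z * S a z) :
    (∀ x ∈ uIcc e a, p x = p' x) ∧ ∀ᵐ x, x ∈ uIcc e a → q x = q' x := by
  have hpi : IntervalIntegrable p volume 0 T := hp.continuousOn.intervalIntegrable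
  have hpi' : IntervalIntegrable p' volume 0 T := hp'.continuousOn.intervalIntegrable
  have hpc : ContinuousOn p (Icc 0 T) := uIcc_of_le hT.le ▸ hp.continuousOn
  have hpc' : ContinuousOn p' (Icc 0 T) := uIcc_of_le hT.le ▸ hp'.continuousOn
  have hεn : ‖ε‖ = 1 := by
    have := congrArg norm hε
    rw [norm_pow, norm_one] at this
    exact (pow_eq_one_iff_of_nonneg (norm_nonneg _) two_ne_zero).mp this
  have hJ : uIcc e a ⊆ Icc 0 T := uIcc_subset_Icc_of_mem he ha
  obtain ⟨φ, dφ, hφ, hφa, hdφa⟩ := exists_isPencilFamily hT hpi hq ha 0 1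
  obtain ⟨φ', dφ', hφ', hφa', hdφa'⟩ := exists_isPencilFamily hT hpi' hq' ha 0 1
  obtain ⟨C, dC, hC, hCa, hdCa⟩ := exists_isPencilFamily hT hpi hq ha 1 0
  obtain ⟨C', dC', hC', hCa', hdCa'⟩ := exists_isPencilFamily hT hpi' hq' ha 1 0
  have hD : IsSineType (S a) (a - e) (∫ t in e..a, p t) :=
    hS.isSineType hT.le hp hq he ha hSe hdSe
  have hℓ : a - e ≠ 0 := sub_ne_zero.mpr hea.symm
  obtain ⟨K₁, R₁, hK₁, hR₁, B₁⟩ := exists_growth_bound hT.le hp hq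
  obtain ⟨K₂, R₂, hK₂, hR₂, B₂⟩ := exists_growth_bound hT.le hp' hq'
  have hsum : ∀ x ∈ uIcc e a, |x - e| + |x - a| = |a - e| := by
    intro x hx
    rcases le_total e a with h | h
    · rw [uIcc_of_le h] at hx
      rw [abs_of_nonneg (by linarith [hx.1]), abs_of_nonpos (by linarith [hx.2]),
        abs_of_nonneg (by linarith)]
      ring
    · rw [uIcc_of_ge h] at hx
      rw [abs_of_nonpos (by linarith [hx.2]), abs_of_nonneg (by linarith [hx.1]),
        abs_of_nonpos (by linarith)]
      ring
  -- For `x` between `e` and `a`, a solution from `e` times a solution from `a` has exactly the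
  -- exponential type of `S a`, so division by `S a` is controlled.
  have hexp : ∀ x ∈ uIcc e a, ∀ z : ℂ, Real.exp (|z.im| * |x - e|) * Real.exp (|z.im| * |x - a|) =
      Real.exp (|z.im| * |a - e|) := by
    intro x hx z
    rw [← Real.exp_add, ← mul_add, hsum x hx]
  -- The cyclic identity `S·W(C,φ) + C·W(φ,S) + φ·W(S,C) = 0`, with Wronskians evaluated at `a`.
  have hSrep : ∀ x ∈ Icc 0 T, ∀ z, S x z = S a z * C x z + dS a z * φ x z := by
    intro x hx z
    have h1 := (hC.solution z).wronskian_eq hT.le (hφ.solution z) ha hx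
    have h2 := (hφ.solution z).wronskian_eq hT.le (hS.solution z) ha hx
    have h3 := (hS.solution z).wronskian_eq hT.le (hC.solution z) ha hx
    simp only [hφa, hdφa, hCa, hdCa] at h1 h2 h3
    linear_combination (-S x z) * h1 - C x z * h2 - φ x z * h3
  have hSrep' : ∀ x ∈ Icc 0 T, ∀ z, S' x z = S' a z * C' x z + dS' a z * φ' x z ∧
      dS' x z = S' a z * dC' x z + dS' a z * dφ' x z := by
    intro x hx z
    have h1 := (hC'.solution z).wronskian_eq hT.le (hφ'.solution z) ha hx
    have h2 := (hφ'.solution z).wronskian_eq hT.le (hS'.solution z) ha hx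
    have h3 := (hS'.solution z).wronskian_eq hT.le (hC'.solution z) ha hx
    simp only [hφa', hdφa', hCa', hdCa'] at h1 h2 h3
    exact ⟨by linear_combination (-S' x z) * h1 - C' x z * h2 - φ' x z * h3,
      by linear_combination (-dS' x z) * h1 - dC' x z * h2 - dφ' x z * h3⟩
  -- the solutions vanishing at `a` are proportional, with a factor not depending on `z`
  have key : ∀ x ∈ uIcc e a, ∃ g : ℂ, ∀ z, φ x z = g * φ' x z := by
    intro x hx
    have hxT := hJ hx
    have d1 := hφ.differentiable x hxT
    have d2 := hφ'.differentiable x hxT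
    have d3 := hC.differentiable x hxT
    have d4 := hC'.differentiable x hxT
    have d5 := hφ'.differentiable_deriv x hxT
    have d6 := hC'.differentiable_deriv x hxT
    have bd : ∀ z, max R₁ R₂ ≤ ‖z‖ →
        (‖S x z‖ ≤ K₁ / ‖z‖ * Real.exp (|z.im| * |x - e|) ∧
        ‖S' x z‖ ≤ K₂ / ‖z‖ * Real.exp (|z.im| * |x - e|) ∧
        ‖dS' x z‖ ≤ K₂ * Real.exp (|z.im| * |x - e|)) ∧
        ‖φ x z‖ ≤ K₁ / ‖z‖ * Real.exp (|z.im| * |x - a|) ∧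
        ‖φ' x z‖ ≤ K₂ / ‖z‖ * Real.exp (|z.im| * |x - a|) ∧
        ‖dφ' x z‖ ≤ K₂ * Real.exp (|z.im| * |x - a|) := by
      intro z hz
      have hz1 := (le_max_left _ _).trans hz
      have hz2 := (le_max_right _ _).trans hz
      have b1 := B₁ z hz1 _ _ (hS.solution z) e he (hSe z) (hdSe z) x hxT
      have b2 := B₂ z hz2 _ _ (hS'.solution z) e he (hSe' z) (hdSe' z) x hxT
      have b3 := B₁ z hz1 _ _ (hφ.solution z) a ha (hφa z) (hdφa z) x hxT
      have b4 := B₂ z hz2 _ _ (hφ'.solution z) a ha (hφa' z) (hdφa' z) x hxT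
      exact ⟨⟨b1.1, b2.1, b2.2⟩, b3.1, b4.1, b4.2⟩
    -- The left factor is visibly entire but contains the uncontrolled `F`; the right side is free
    -- of `F` and is `O(1/‖z‖²)` times the exponential. Together they force both to vanish.
    have hid₀ : ∀ z, S a z * (C x z * φ' x z - C' x z * φ x z - F z * φ x z * φ' x z) =
        S x z * φ' x z - ε * S' x z * φ x z := by
      intro z
      rw [hSrep x hxT z, (hSrep' x hxT z).1, hval]
      linear_combination (φ x z * φ' x z) * (hslope z) + (S a z * C' x z * φ x z) * hε
    have hzero : ∀ z, C x z * φ' x z - C' x z * φ x z - F z * φ x z * φ' x z = 0 := by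
      refine hD.eq_zero_of_mul_le hℓ (by fun_prop) (K := 2 * K₁ * K₂) (R₀ := max R₁ R₂)
        (by positivity) fun z hz => ?_
      obtain ⟨⟨b1, b2, -⟩, b4, b5, -⟩ := bd z hz
      rw [hid₀]
      refine (norm_sub_le _ _).trans ?_
      rw [norm_mul, norm_mul, norm_mul, hεn, one_mul]
      calc _ ≤ (K₁ / ‖z‖ * Real.exp (|z.im| * |x - e|)) * (K₂ / ‖z‖ * Real.exp (|z.im| * |x - a|))
            + (K₂ / ‖z‖ * Real.exp (|z.im| * |x - e|)) * (K₁ / ‖z‖ * Real.exp (|z.im| * |x - a|)) := by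
              gcongr
        _ = 2 * K₁ * K₂ / ‖z‖ ^ 2 *
            (Real.exp (|z.im| * |x - e|) * Real.exp (|z.im| * |x - a|)) := by ring
        _ = _ := by rw [hexp x hx]
    have hSφ : ∀ z, S x z * φ' x z = ε * S' x z * φ x z := fun z => by
      linear_combination S a z * hzero z - hid₀ z
    -- An entry of the matrix mapping solutions of one pencil to those of the other. Its product
    -- with `S a` is only `O(1/‖z‖)`, hence `P` is constant in `z`.
    set P : ℂ → ℂ := fun z => φ x z * dC' x z - C x z * dφ' x z + F z * φ x z * dφ' x z with hP
    have hPd : Differentiable ℂ P := by fun_prop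
    have hid : ∀ z, S a z * P z = ε * φ x z * dS' x z - S x z * dφ' x z := by
      intro z
      simp only [hP]
      rw [hSrep x hxT z, (hSrep' x hxT z).2, hval]
      linear_combination (-φ x z * dφ' x z) * (hslope z) - (S a z * dC' x z * φ x z) * hε
    have hPc := hD.eq_const_of_mul_le hℓ hPd (K := 2 * K₁ * K₂) (R₀ := max R₁ R₂) (fun z hz => by
      obtain ⟨⟨b1, -, b3⟩, b4, -, b6⟩ := bd z hz
      rw [hid]
      refine (norm_sub_le _ _).trans ?_
      rw [norm_mul, norm_mul, norm_mul, hεn, one_mul]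
      calc _ ≤ (K₁ / ‖z‖ * Real.exp (|z.im| * |x - a|)) * (K₂ * Real.exp (|z.im| * |x - e|))
            + (K₁ / ‖z‖ * Real.exp (|z.im| * |x - e|)) * (K₂ * Real.exp (|z.im| * |x - a|)) := by
              gcongr
        _ = 2 * K₁ * K₂ / ‖z‖ *
            (Real.exp (|z.im| * |x - e|) * Real.exp (|z.im| * |x - a|)) := by ring
        _ = _ := by rw [hexp x hx])
    refine ⟨-P 0, fun z => ?_⟩
    -- The product with `S a` vanishes identically; taking `K = 0` cancels `S a` even at its zeros.
    have hz := hD.eq_zero_of_mul_le hℓ (r := fun z => φ' x z * P z + φ x z) (by fun_prop) (K := 0)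
      (R₀ := 0) le_rfl (fun z _ => by
        have h1 := (hφ'.solution z).wronskian_eq hT.le (hS'.solution z) ha hxT
        simp only [hφa', hdφa', hval] at h1
        have : S a z * (φ' x z * P z + φ x z) = 0 := by
          linear_combination φ' x z * hid z - dφ' x z * hSφ z + ε * φ x z * h1 -
            (S a z * φ x z) * hε
        rw [this]
        simp) z
    simp only [hPc z 0] at hz
    linear_combination hz
  have hsine : ∀ x ∈ uIcc e a, IsSineType (φ x) (x - a) (∫ t in a..x, p t) := fun x hx =>
    hφ.isSineType hT.le hp hq ha (hJ hx) hφa hdφa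
  have hsine' : ∀ x ∈ uIcc e a, IsSineType (φ' x) (x - a) (∫ t in a..x, p' t) := fun x hx =>
    hφ'.isSineType hT.le hp' hq' ha (hJ hx) hφa' hdφa'
  -- The two half-axes give `g² = 1`, and the factor 2 in the exponent removes the unknown sign of
  -- `g`.
  have hphase : ∀ x ∈ uIcc e a, Complex.exp (2 * Complex.I *
      ((∫ t in a..x, p t) - ∫ t in a..x, p' t)) = 1 := by
    intro x hx
    rcases eq_or_ne x a with rfl | hxa
    · simp
    obtain ⟨g, hg⟩ := key x hx
    have hxa' : x - a ≠ 0 := sub_ne_zero.mpr hxa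
    have h1 := (hsine' x hx).exp_eq_of_eq_const_mul hxa' (hsine x hx) hg Complex.I_sq
    have h2 := (hsine' x hx).exp_eq_of_eq_const_mul hxa' (hsine x hx) hg (κ := -Complex.I) (by simp)
    set ω := ∫ t in a..x, p t
    set ω' := ∫ t in a..x, p' t
    have h3 : Complex.exp (2 * Complex.I * (ω - ω')) = Complex.exp (Complex.I * ω) *
        Complex.exp (-Complex.I * ω') * (Complex.exp (Complex.I * ω) *
        Complex.exp (-Complex.I * ω')) := by
      rw [← Complex.exp_add, ← Complex.exp_add]; congr 1; ring
    have h4 : Complex.exp (Complex.I * ω') * Complex.exp (-Complex.I * ω') = 1 := by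
      rw [← Complex.exp_add]; simp
    have h5 : Complex.exp (Complex.I * ω) * Complex.exp (-Complex.I * ω) = 1 := by
      rw [← Complex.exp_add]; simp
    rw [h1, h2] at h5
    have h6 : g ^ 2 = 1 := by linear_combination h5 - g ^ 2 * h4
    rw [h3, h1]
    linear_combination (g ^ 2 * (Complex.exp (Complex.I * ω') * Complex.exp (-Complex.I * ω') + 1)) * h4
      + h6
  have hu : UniqueDiffOn ℝ (uIcc e a) := uniqueDiffOn_uIcc hea
  -- Differentiating the identity in `x` avoids choosing a branch of the logarithm.
  have hpp : ∀ x ∈ uIcc e a, p x = p' x := by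
    intro x hx
    have h1 := ((hasDerivWithinAt_integral_of_continuousOn hpc ha (hJ hx)).sub
      (hasDerivWithinAt_integral_of_continuousOn hpc' ha (hJ hx))).mono hJ
    have h2 := (h1.const_mul (2 * Complex.I)).cexp
    have h3 : HasDerivWithinAt (fun _ : ℝ => (1 : ℂ)) 0 (uIcc e a) x := hasDerivWithinAt_const _ _ _
    have h4 := (hu x hx).eq_deriv _ h2 (h3.congr (fun y hy => hphase y hy) (hphase x hx))
    simp only [Pi.sub_apply] at h4
    rw [hphase x hx, one_mul] at h4
    have h5 : (2 : ℂ) * Complex.I ≠ 0 := by simp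
    exact sub_eq_zero.mp ((mul_eq_zero.mp h4).resolve_left h5)
  have hφφ : ∀ x ∈ uIcc e a, ∀ z, φ x z = φ' x z := by
    intro x hx z
    rcases eq_or_ne x a with rfl | hxa
    · rw [hφa, hφa']
    obtain ⟨g, hg⟩ := key x hx
    have hxa' : x - a ≠ 0 := sub_ne_zero.mpr hxa
    have h1 := (hsine' x hx).exp_eq_of_eq_const_mul hxa' (hsine x hx) hg Complex.I_sq
    have h2 : (∫ t in a..x, p t) = ∫ t in a..x, p' t :=
      intervalIntegral.integral_congr fun t ht =>
        hpp t (uIcc_subset_uIcc right_mem_uIcc hx ht)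
    rw [h2] at h1
    have h3 : (1 - g) * Complex.exp (Complex.I * ∫ t in a..x, p' t) = 0 := by
      linear_combination h1
    have h4 := (mul_eq_zero.mp h3).resolve_right (Complex.exp_ne_zero _)
    rw [hg, ← sub_eq_zero.mp h4, one_mul]
  have hdφφ : ∀ x ∈ uIcc e a, ∀ z, dφ x z = dφ' x z := fun x hx z =>
    (hu x hx).eq_deriv _ (((hφ.solution z).hasDeriv x (hJ hx)).mono hJ)
      ((((hφ'.solution z).hasDeriv x (hJ hx)).mono hJ).congr (fun y hy => hφφ y hy z)
        (hφφ x hx z))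
  refine ⟨hpp, ?_⟩
  -- Restricting `z` to a countable dense set gives one null set for all parameters; density and
  -- continuity then supply one with `φ x z ≠ 0`.
  have hae := ae_all_iff.mpr fun n : ℕ => (hφ.solution (TopologicalSpace.denseSeq ℂ n)).ae_hasDerivAt
  have hae' := ae_all_iff.mpr fun n : ℕ =>
    (hφ'.solution (TopologicalSpace.denseSeq ℂ n)).ae_hasDerivAt
  have h2 : ∀ᵐ x : ℝ, x ≠ e := by simp [ae_iff, measure_singleton]
  have h3 : ∀ᵐ x : ℝ, x ≠ a := by simp [ae_iff, measure_singleton]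
  filter_upwards [hae, hae', h2, h3] with x k1 k2 k3 k4 hx
  have hnhds : uIcc e a ∈ nhds x := by
    refine Icc_mem_nhds (lt_of_le_of_ne hx.1 ?_) (lt_of_le_of_ne hx.2 ?_)
    · rcases min_choice e a with h | h <;> rw [h] <;> first | exact k3.symm | exact k4.symm
    · rcases max_choice e a with h | h <;> rw [h] <;> assumption
  obtain ⟨z, hz⟩ := (hsine x hx).exists_ne_zero (sub_ne_zero.mpr k4)
  have hopen : IsOpen {z | φ x z ≠ 0} :=
    isOpen_ne_fun (hφ.differentiable x (hJ hx)).continuous continuous_const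
  obtain ⟨n, hn⟩ := (TopologicalSpace.denseRange_denseSeq ℂ).exists_mem_open hopen ⟨z, hz⟩
  have hev : (fun t => dφ t (TopologicalSpace.denseSeq ℂ n)) =ᶠ[nhds x]
      fun t => dφ' t (TopologicalSpace.denseSeq ℂ n) := by
    filter_upwards [hnhds] with t ht using hdφφ t ht _
  have hder := (k1 n (hJ hx)).unique ((k2 n (hJ hx)).congr_of_eventuallyEq hev)
  rw [← hφφ x hx] at hder
  have hQ := mul_right_cancel₀ hn hder
  rw [pencilPotential, pencilPotential, hpp x hx] at hQ
  linear_combination hQ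

/-! ### Characteristic functions and the three-spectra theorem. -/

theorem pencilCauchy_eq {T : ℝ} (hT : 0 < T) {p q : ℝ → ℂ}
    (hp : IntervalIntegrable p volume 0 T) (hq : IntervalIntegrable q volume 0 T) {z : ℂ}
    {y dy : ℝ → ℂ} (h : IsPencilSolution T p q z y dy) {x : ℝ} (hx : x ∈ Icc 0 T) :
    pencilCauchy T p q (y 0) (dy 0) z x = y x := by
  obtain ⟨dw, hw, h1, h2⟩ := Classical.epsilon_spec
    (p := fun w : ℝ → ℂ => ∃ dw, IsPencilSolution T p q z w dw ∧ w 0 = y 0 ∧ dw 0 = dy 0)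
    ⟨y, dy, h, rfl, rfl⟩
  exact (hw.eq_of_initial hT hp hq h h1 h2 x hx).1

/-- As a function of `d`, the determinant solves the equation, vanishes at `c` and has there the
Wronskian 1 as slope. Spectra thereby become zeros of `S d`. -/
theorem exists_isPencilFamily_dirichletCharFun {T : ℝ} (hT : 0 < T) {p q : ℝ → ℂ}
    (hp : IntervalIntegrable p volume 0 T) (hq : IntervalIntegrable q volume 0 T) {c : ℝ}
    (hc : c ∈ Icc 0 T) :
    ∃ S dS : ℝ → ℂ → ℂ, IsPencilFamily T p q S dS ∧ (∀ z, S c z = 0) ∧ (∀ z, dS c z = 1) ∧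
      ∀ d ∈ Icc 0 T, dirichletCharFun T p q c d = S d := by
  have h0 : (0 : ℝ) ∈ Icc 0 T := ⟨le_rfl, hT.le⟩
  obtain ⟨S, dS, hS, hSc, hdSc⟩ := exists_isPencilFamily hT hp hq hc 0 1
  obtain ⟨Y, dY, hY, hY0, hdY0⟩ := exists_isPencilFamily hT hp hq h0 1 0
  obtain ⟨Z, dZ, hZ, hZ0, hdZ0⟩ := exists_isPencilFamily hT hp hq h0 0 1
  refine ⟨S, dS, hS, hSc, hdSc, fun d hd => funext fun z => ?_⟩
  have e1 : ∀ x ∈ Icc 0 T, pencilX₁ T p q x z = Y x z := fun x hx => by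
    have := pencilCauchy_eq hT hp hq (hY.solution z) hx
    rwa [hY0, hdY0] at this
  have e2 : ∀ x ∈ Icc 0 T, pencilX₂ T p q x z = Z x z := fun x hx => by
    have := pencilCauchy_eq hT hp hq (hZ.solution z) hx
    rwa [hZ0, hdZ0] at this
  rw [dirichletCharFun, e1 c hc, e1 d hd, e2 c hc, e2 d hd]
  have h1 := (hY.solution z).wronskian_eq hT.le (hZ.solution z) h0 hd
  have h2 := (hZ.solution z).wronskian_eq hT.le (hS.solution z) hc hd
  have h3 := (hS.solution z).wronskian_eq hT.le (hY.solution z) hc hd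
  simp only [hY0, hdY0, hZ0, hdZ0, hSc, hdSc] at h1 h2 h3
  linear_combination S d z * h1 + Y d z * h2 + Z d z * h3

theorem IsSineType.exists_norm_le {D : ℂ → ℂ} {ℓ : ℝ} {ω : ℂ} (hD : IsSineType D ℓ ω) :
    ∃ K R : ℝ, ∀ z : ℂ, R ≤ ‖z‖ → ‖D z‖ ≤ K / ‖z‖ * Real.exp (|z.im| * |ℓ|) := by
  obtain ⟨C, R, hC, hR, H⟩ := hD.asymptotics
  refine ⟨C / R + Real.exp |ω.im|, R, fun z hz => ?_⟩
  have hz0 : 0 < ‖z‖ := hR.trans_le hz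
  have h1 := H z hz
  have h2 : ‖Complex.sin (z * ℓ - ω)‖ ≤ Real.exp |ω.im| * Real.exp (|z.im| * |ℓ|) := by
    refine (norm_sin_le_exp _).trans ?_
    rw [← Real.exp_add, Real.exp_le_exp, ← abs_mul]
    have : (z * ℓ - ω).im = z.im * ℓ - ω.im := by simp
    rw [this, add_comm]
    exact abs_sub _ _
  have h3 := norm_sub_norm_le (z * D z) (Complex.sin (z * ℓ - ω))
  rw [norm_mul] at h3
  have h4 : C / ‖z‖ * Real.exp (|z.im| * |ℓ|) ≤ C / R * Real.exp (|z.im| * |ℓ|) := by gcongr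
  rw [div_mul_eq_mul_div, le_div_iff₀ hz0]
  linarith

/-- Functions of sine type with the same zeros are proportional. -/
theorem IsSineType.exists_eq_const_mul {D D' : ℂ → ℂ} {ℓ : ℝ} {ω ω' : ℂ}
    (hD : IsSineType D ℓ ω) (hD' : IsSineType D' ℓ ω') (hℓ : ℓ ≠ 0)
    (h : ∀ z, analyticOrderAt D z ≤ analyticOrderAt D' z) : ∃ c : ℂ, ∀ z, D' z = c * D z := by
  obtain ⟨r, hr, hrD⟩ := exists_differentiable_eq_mul hD'.differentiable hD.differentiable
    (hD.exists_ne_zero hℓ) h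
  obtain ⟨K, R, hK⟩ := hD'.exists_norm_le
  refine ⟨r 0, fun z => ?_⟩
  rw [hrD, hD.eq_const_of_mul_le hℓ hr (K := K) (R₀ := R)
    (fun z hz => by rw [mul_comm, ← hrD]; exact hK z hz) z 0]

theorem dirichletCharFun_swap (T : ℝ) (p q : ℝ → ℂ) (c d : ℝ) (z : ℂ) :
    dirichletCharFun T p q d c z = -dirichletCharFun T p q c d z := by
  rw [dirichletCharFun, dirichletCharFun]; ring

theorem IsPencilSolution.mem_dirichletEigenvalues {T : ℝ} (hT : 0 < T) {p q : ℝ → ℂ} {z : ℂ}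
    {y dy : ℝ → ℂ} (h : IsPencilSolution T p q z y dy) (hdy : dy 0 ≠ 0) {c d : ℝ} (hc : y c = 0)
    (hd : y d = 0) : z ∈ dirichletEigenvalues T p q c d := by
  have h0 : (0 : ℝ) ∈ Icc 0 T := ⟨le_rfl, hT.le⟩
  refine ⟨y, dy, h, ?_, hc, hd⟩
  by_contra! hy
  refine hdy ((uniqueDiffOn_Icc hT 0 h0).eq_deriv _ (h.hasDeriv 0 h0) ?_)
  exact (hasDerivWithinAt_const (0 : ℝ) (Icc 0 T) (0 : ℂ)).congr hy (hy 0 h0)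

theorem theorem4 (T a : ℝ) (ha : a ∈ Ioo 0 T)
    (p q pt qt : ℝ → ℂ)
    (hp : AbsolutelyContinuousOnInterval p 0 T) (hq : IntervalIntegrable q volume 0 T)
    (hp' : AbsolutelyContinuousOnInterval pt 0 T) (hq' : IntervalIntegrable qt volume 0 T)
    (hint : ∫ x in (0 : ℝ)..T, p x = ∫ x in (0 : ℝ)..T, pt x)
    (hS : dirichletEigenvalues T p q 0 a ∩ dirichletEigenvalues T p q 0 T = ∅)
    (h₀ : dirichletSpectrum T p q 0 a = dirichletSpectrum T pt qt 0 a)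
    (h₁ : dirichletSpectrum T p q 0 T = dirichletSpectrum T pt qt 0 T)
    (h₂ : dirichletSpectrum T p q a T = dirichletSpectrum T pt qt a T) :
    (∀ x ∈ Icc 0 T, p x = pt x) ∧ q =ᵐ[volume.restrict (Ioo 0 T)] qt := by
  have hT : 0 < T := ha.1.trans ha.2
  have hpi : IntervalIntegrable p volume 0 T := hp.continuousOn.intervalIntegrable
  have hpi' : IntervalIntegrable pt volume 0 T := hp'.continuousOn.intervalIntegrable
  have m0 : (0 : ℝ) ∈ Icc 0 T := ⟨le_rfl, hT.le⟩
  have mT : T ∈ Icc 0 T := ⟨hT.le, le_rfl⟩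
  have ma : a ∈ Icc 0 T := Ioo_subset_Icc_self ha
  obtain ⟨U, dU, hU, hU0, hdU0, eU⟩ := exists_isPencilFamily_dirichletCharFun hT hpi hq m0
  obtain ⟨V, dV, hV, hV0, hdV0, eV⟩ := exists_isPencilFamily_dirichletCharFun hT hpi hq ma
  obtain ⟨W, dW, hW, hW0, hdW0, eW⟩ := exists_isPencilFamily_dirichletCharFun hT hpi hq mT
  obtain ⟨U', dU', hU', hU0', hdU0', eU'⟩ := exists_isPencilFamily_dirichletCharFun hT hpi' hq' m0
  obtain ⟨V', dV', hV', hV0', hdV0', eV'⟩ := exists_isPencilFamily_dirichletCharFun hT hpi' hq' ma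
  obtain ⟨W', dW', hW', hW0', hdW0', eW'⟩ := exists_isPencilFamily_dirichletCharFun hT hpi' hq' mT
  have sU := fun x hx => hU.isSineType (x := x) hT.le hp hq m0 hx hU0 hdU0
  have sU' := fun x hx => hU'.isSineType (x := x) hT.le hp' hq' m0 hx hU0' hdU0'
  have sV := hV.isSineType hT.le hp hq ma mT hV0 hdV0
  have sV' := hV'.isSineType hT.le hp' hq' ma mT hV0' hdV0'
  have l1 : a - 0 ≠ 0 := by linarith [ha.1]
  have l2 : T - 0 ≠ 0 := by linarith
  have l3 : T - a ≠ 0 := by linarith [ha.2]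
  obtain ⟨ε, hε⟩ := (sU a ma).exists_eq_const_mul (sU' a ma) l1 fun z => by
    have := congrFun h₀ z
    rw [dirichletSpectrum, dirichletSpectrum, eU a ma, eU' a ma] at this
    exact this.le
  obtain ⟨c, hc⟩ := (sU T mT).exists_eq_const_mul (sU' T mT) l2 fun z => by
    have := congrFun h₁ z
    rw [dirichletSpectrum, dirichletSpectrum, eU T mT, eU' T mT] at this
    exact this.le
  obtain ⟨ε', hε'⟩ := sV.exists_eq_const_mul sV' l3 fun z => by
    have := congrFun h₂ z
    rw [dirichletSpectrum, dirichletSpectrum, eV T mT, eV' T mT] at this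
    exact this.le
  have hc1 : c = 1 := by
    have h := (sU T mT).exp_eq_of_eq_const_mul l2 (sU' T mT) hc Complex.I_sq
    rw [hint] at h
    have : (1 - c) * Complex.exp (Complex.I * ∫ x in (0 : ℝ)..T, pt x) = 0 := by
      linear_combination h
    exact (sub_eq_zero.mp ((mul_eq_zero.mp this).resolve_right (Complex.exp_ne_zero _))).symm
  subst hc1
  have k1 := (sU a ma).exp_eq_of_eq_const_mul l1 (sU' a ma) hε Complex.I_sq
  have k2 := (sU a ma).exp_eq_of_eq_const_mul l1 (sU' a ma) hε (κ := -Complex.I) (by simp)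
  have k3 := sV.exp_eq_of_eq_const_mul l3 sV' hε' Complex.I_sq
  have hεε : ε ^ 2 = 1 := by
    have e1 : ∀ w : ℂ, Complex.exp (Complex.I * w) * Complex.exp (-Complex.I * w) = 1 := fun w => by
      rw [← Complex.exp_add]; simp
    have h := e1 (∫ x in (0 : ℝ)..a, pt x)
    rw [k1, k2] at h
    linear_combination h - ε ^ 2 * e1 (∫ x in (0 : ℝ)..a, p x)
  -- Additivity of the integral over `[0,a]` and `[a,T]` multiplies the phase relations, so `ε ε' =
  -- 1`.
  have hεε' : ε' = ε := by
    have e1 := intervalIntegral.integral_add_adjacent_intervals (hpi.of_mem_Icc m0 ma)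
      (hpi.of_mem_Icc ma mT)
    have e2 := intervalIntegral.integral_add_adjacent_intervals (hpi'.of_mem_Icc m0 ma)
      (hpi'.of_mem_Icc ma mT)
    have h : Complex.exp (Complex.I * ∫ x in (0 : ℝ)..T, p x) =
        ε * ε' * Complex.exp (Complex.I * ∫ x in (0 : ℝ)..T, p x) := by
      conv_lhs => rw [hint, ← e2, mul_add, Complex.exp_add, k1, k3]
      rw [← e1, mul_add, Complex.exp_add]
      ring
    have h' : (1 - ε * ε') * Complex.exp (Complex.I * ∫ x in (0 : ℝ)..T, p x) = 0 := by
      linear_combination h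
    have h2 := (mul_eq_zero.mp h').resolve_right (Complex.exp_ne_zero _)
    linear_combination (-ε') * hεε - ε * h2
  subst hεε'
  rename' ε' => ε
  have hWV : ∀ z, W a z = -V T z := fun z => by
    rw [← eW a ma, ← eV T mT, dirichletCharFun_swap]
  have hWV' : ∀ z, W' a z = -V' T z := fun z => by
    rw [← eW' a ma, ← eV' T mT, dirichletCharFun_swap]
  have hdecomp : ∀ z, U T z = U a z * dW a z + dU a z * V T z := fun z => by
    have h := (hU.solution z).wronskian_eq hT.le (hW.solution z) ma mT
    simp only [hW0, hdW0, hWV] at h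
    linear_combination h
  have hdecomp' : ∀ z, U' T z = U' a z * dW' a z + dU' a z * V' T z := fun z => by
    have h := (hU'.solution z).wronskian_eq hT.le (hW'.solution z) ma mT
    simp only [hW0', hdW0', hWV'] at h
    linear_combination h
  have hrel : ∀ z, V T z * (ε * dU' a z - dU a z) = U a z * (dW a z - ε * dW' a z) := fun z => by
    have h1 := hdecomp z
    have h2 := hdecomp' z
    rw [hc, hε, hε'] at h2
    linear_combination h1 - h2
  -- A common zero would also be a zero of `U T` by `hdecomp`, making it a common eigenvalue of the
  -- problems on `(0,a)` and `(0,T)`.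
  have hnz : ∀ z, U a z = 0 → V T z ≠ 0 := fun z h1 h2 => by
    have hUT : U T z = 0 := by rw [hdecomp, h1, h2]; ring
    have hne : dU 0 z ≠ 0 := by rw [hdU0]; exact one_ne_zero
    have : z ∈ dirichletEigenvalues T p q 0 a ∩ dirichletEigenvalues T p q 0 T :=
      ⟨(hU.solution z).mem_dirichletEigenvalues hT hne (hU0 z) h1,
        (hU.solution z).mem_dirichletEigenvalues hT hne (hU0 z) hUT⟩
    rw [hS] at this
    exact this
  have dUa := hU.differentiable a ma
  have dVT := hV.differentiable T mT
  have ddU := hU.differentiable_deriv a ma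
  have ddU' := hU'.differentiable_deriv a ma
  have ddW := hW.differentiable_deriv a ma
  have ddW' := hW'.differentiable_deriv a ma
  have dN : Differentiable ℂ fun z => ε * dU' a z - dU a z := by fun_prop
  have dG : Differentiable ℂ fun z => dW a z - ε * dW' a z := by fun_prop
  -- Orders in `hrel` are compared: at a zero of `U a` the factor `V T` contributes order 0, so
  -- divisibility holds with multiplicity.
  obtain ⟨F, hF, hFeq⟩ := exists_differentiable_eq_mul dN dUa ((sU a ma).exists_ne_zero l1)
    fun z => by
      by_cases hz : U a z = 0
      · have h1 : analyticOrderAt (V T) z = 0 := (dVT.analyticAt z).analyticOrderAt_eq_zero.mpr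
          (hnz z hz)
        have h2 := analyticOrderAt_mul (dVT.analyticAt z) (dN.analyticAt z)
        have h3 := analyticOrderAt_mul (dUa.analyticAt z) (dG.analyticAt z)
        have h4 : (V T * fun z => ε * dU' a z - dU a z) = U a * fun z => dW a z - ε * dW' a z :=
          funext hrel
        rw [h1, zero_add, h4, h3] at h2
        rw [← h2]
        exact le_self_add
      · rw [(dUa.analyticAt z).analyticOrderAt_eq_zero.mpr hz]
        exact zero_le
  -- Cancelling `U a` in `hrel` shows that the same `F` serves the segment `[a, T]`, seen from the
  -- endpoint `T`.
  have hFW : ∀ z, ε * dW' a z - dW a z = F z * W a z := fun z => by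
    have h := (sU a ma).eq_zero_of_mul_le l1
      (r := fun z => V T z * F z - (dW a z - ε * dW' a z)) (by fun_prop) (K := 0) (R₀ := 0) le_rfl
      (fun z _ => by
        have : U a z * (V T z * F z - (dW a z - ε * dW' a z)) = 0 := by
          linear_combination hrel z - V T z * hFeq z
        rw [this]; simp) z
    rw [hWV]
    linear_combination h
  obtain ⟨L1, L2⟩ := coefficients_eq_of_weyl_eq hT hp hq hp' hq' m0 ma ha.1.ne hU hU' hU0 hdU0
    hU0' hdU0' hεε hε hF hFeq
  obtain ⟨R1, R2⟩ := coefficients_eq_of_weyl_eq hT hp hq hp' hq' mT ma ha.2.ne' hW hW' hW0 hdW0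
    hW0' hdW0' hεε (fun z => by rw [hWV, hWV', hε']; ring) hF hFW
  have hcover : ∀ x ∈ Icc 0 T, x ∈ uIcc 0 a ∨ x ∈ uIcc T a := fun x hx => by
    rw [uIcc_of_le ha.1.le, uIcc_of_ge ha.2.le]
    rcases le_total x a with h | h
    · exact Or.inl ⟨hx.1, h⟩
    · exact Or.inr ⟨h, hx.2⟩
  refine ⟨fun x hx => (hcover x hx).elim (L1 x) (R1 x), ?_⟩
  rw [Filter.EventuallyEq, ae_restrict_iff' measurableSet_Ioo]
  filter_upwards [L2, R2] with x e1 e2 hx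
  exact (hcover x (Ioo_subset_Icc_self hx)).elim e1 e2
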